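/- **Definitions.** An *SMC-category* is a bicategory $\mathbf B$ with a symmetric monoidal structure $(\oplus,\mathbf 0)$ on every category $\mathbf B(a,b)$, for which composition is bilinear: for every $1$-cell $f$ the functors $f\circ(-)$ and $(-)\circ f$ between hom-categories are equipped with symmetric strong monoidal structures (distributivity isomorphisms and isomorphisms $f\circ\mathbf 0\cong\mathbf 0$, $\mathbf 0\circ f\cong\mathbf 0$) such that 1. the same isomorphisms make $f\mapsto f\circ(-)$ and $f\mapsto(-)\circ f$ into symmetric strong monoidal functors from $\mathbf B(b,c)$ to $\mathbf{SymMon}(\mathbf B(a,b),\mathbf B(a,c))$ and from $\mathbf B(a,b)$ to $\mathbf{SymMon}(\mathbf B(b,c),\mathbf B(a,c))$ respectively, where $\mathbf{SymMon}(\mathbf X,\mathbf Y)$ is the category of symmetric strong monoidal functors and monoidal transformations, with the pointwise symmetric monoidal structure; explicitly, $2$-cells $f\Rightarrow f'$ induce monoidal transformations $f\circ(-)\Rightarrow f'\circ(-)$ and $(-)\circ f\Rightarrow(-)\circ f'$, and the isomorphisms $(f\oplus g)\circ-\cong(f\circ-)\oplus(g\circ-)$, $-\circ(f\oplus g)\cong(-\circ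 f)\oplus(-\circ g)$, $\mathbf 0\circ-\cong\mathbf 0$ and $-\circ\mathbf 0\cong\mathbf 0$ are monoidal; 2. the associativity and unit isomorphisms $f\circ(g\circ-)\cong(f\circ g)\circ-$, $(-\circ f)\circ g\cong-\circ(f\circ g)$, $f\circ(-\circ g)\cong(f\circ-)\circ g$, $-\circ\mathbf 1\cong\mathrm{id}$ and $\mathbf 1\circ-\cong\mathrm{id}$ are monoidal. An *SMC-functor* $F:\mathbf B\to\mathbf C$ is a pseudofunctor such that every $F:\mathbf B(a,b)\to\mathbf C(Fa,Fb)$ is equipped with a symmetric strong monoidal structure and the isomorphisms $F(g\circ f)\cong Fg\circ Ff$ are monoidal in $f$ and in $g$ separately. A (strong) *monoidal transformation* $\eta:F\Rightarrow G$ of SMC-functors is a strong (pseudonatural) transformation whose invertible $2$-cells $\eta_b\circ Ff\cong Gf\circ\eta_a$ form, for all $a,b$, a monoidal natural transformation in $f\in\mathbf B(a,b)$. A *modification* between monoidal transformations is a modification in the sense of bicategories. For SMC-categories $\mathbf B,\mathbf C$, let $\mathbf{SMC\text{-}Cat}(\mathbf B,\mathbf C)$ be the bicategory of SMC-functors $\mathbf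 B\to\mathbf C$, monoidal transformations and modifications. It is itself an SMC-category: sums are formed componentwise, $(\eta\oplus\sigma)_b=\eta_b\oplus\sigma_b$, where the $2$-cell of $\eta\oplus\sigma$ at $f$ is $\eta_f\oplus\sigma_f$ conjugated with the distributivity isomorphisms of $\mathbf C$, the zero transformation has components $\mathbf 0$, and all structure isomorphisms are those of $\mathbf C$ componentwise. A *biequivalence* from $\mathbf B$ to $\mathbf C$ consists of SMC-functors $F:\mathbf B\to\mathbf C$ and $G:\mathbf C\to\mathbf B$ together with an equivalence $FG\simeq 1_{\mathbf C}$ in the bicategory $\mathbf{SMC\text{-}Cat}(\mathbf C,\mathbf C)$ and an equivalence $1_{\mathbf B}\simeq GF$ in the bicategory $\mathbf{SMC\text{-}Cat}(\mathbf B,\mathbf B)$; an SMC-functor $F$ *is a biequivalence* if such a $G$ and such equivalences exist. For SMC-categories $\mathbf B,\mathbf C,\mathbf D$ and an SMC-functor $J:\mathbf C\to\mathbf D$, *postcomposition with $J$* is the SMC-functor $$J_*:\mathbf{SMC\text{-}Cat}(\mathbf B,\mathbf C)\to\mathbf{SMC\text{-}Cat}(\mathbf B,\mathbf D),\qquad J_*(F)=J\circ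 F,\quad J_*(\eta)_b=J(\eta_b),\quad J_*(M)_b=J(M_b),$$ where the $2$-cell of $J_*(\eta)$ at $f$ is $J(\eta_f)$ conjugated with the isomorphisms $J(h\circ k)\cong Jh\circ Jk$, and whose structure isomorphisms (for identities, composition, sums and zero) are those of $J$ componentwise. **Lemma.** Let $\mathbf B$, $\mathbf C$ and $\mathbf D$ be SMC-categories, and let the SMC-functor $J:\mathbf C\to\mathbf D$ be a biequivalence. Then the SMC-functor $J_*:\mathbf{SMC\text{-}Cat}(\mathbf B,\mathbf C)\to\mathbf{SMC\text{-}Cat}(\mathbf B,\mathbf D)$ is a biequivalence. -/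

import Mathlib

open CategoryTheory Bicategory

universe w v u w₁ v₁ u₁ w₂ v₂ u₂ w₃ v₃ u₃ w₄ v₄ u₄

/-- The sum of `1`-cells. -/
local infixr:70 " ⊞ " => MonoidalCategoryStruct.tensorObj
/-- The sum of `2`-cells. -/
local infixr:70 " ⊞ₘ " => MonoidalCategoryStruct.tensorHom
/-- The zero `1`-cell. -/
local notation "𝟬" => MonoidalCategoryStruct.tensorUnit _

/-- An SMC-category (a bicategory weakly enriched in symmetric monoidal categories): a bicategory
with a symmetric monoidal structure `(⊞, 𝟬)` on every hom-category such that composition is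
bilinear. Composition is in diagrammatic order; `precomp c f` is the functor `f ≫ -` and
`postcomp a g` is the functor `- ≫ g`.

Bilinearity consists of the symmetric strong monoidal structures `precompBraided` and
`postcompBraided`, that is, of natural isomorphisms `f ≫ g ⊞ f ≫ g' ≅ f ≫ (g ⊞ g')`, `𝟬 ≅ f ≫ 𝟬`,
`f ≫ g ⊞ f' ≫ g ≅ (f ⊞ f') ≫ g` and `𝟬 ≅ 𝟬 ≫ g`. The same isomorphisms serve as the structure
isomorphisms of the two adjoints `f ↦ (f ≫ -)` and `g ↦ (- ≫ g)` of composition; `precomp_natural`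
and `postcomp_natural` say that these adjoints take values in monoidal functors and monoidal
transformations, and the four axioms `null_null`, `sum_null`, `null_sum`, `sum_sum` say that the
structure isomorphisms of the adjoints are monoidal transformations. The remaining axioms say that
the associators and unitors of the bicategory, as transformations in each variable separately, are
monoidal. -/
class SMCCategory (B : Type u) [Bicategory.{w, v} B] where
  /-- each hom-category is monoidal -/
  monoidal (a b : B) : MonoidalCategory (a ⟶ b)
  /-- each hom-category is symmetric monoidal -/
  symmetric (a b : B) : SymmetricCategory (a ⟶ b)
  /-- `f ≫ -` is a symmetric strong monoidal functor -/
  precompBraided {a b : B} (f : a ⟶ b) (c : B) : (precomp c f).Braided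
  /-- `- ≫ g` is a symmetric strong monoidal functor -/
  postcompBraided {b c : B} (g : b ⟶ c) (a : B) : (postcomp a g).Braided
  /-- a `2`-cell `φ : f ⟶ f'` induces a monoidal transformation from `f ≫ -` to `f' ≫ -` -/
  precomp_natural {a b : B} (c : B) {f f' : a ⟶ b} (φ : f ⟶ f') :
    NatTrans.IsMonoidal (F₁ := precomp c f) (F₂ := precomp c f') ((precomposing a b c).map φ)
  /-- a `2`-cell `ψ : g ⟶ g'` induces a monoidal transformation from `- ≫ g` to `- ≫ g'` -/
  postcomp_natural (a : B) {b c : B} {g g' : b ⟶ c} (ψ : g ⟶ g') :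
    NatTrans.IsMonoidal (F₁ := postcomp a g) (F₂ := postcomp a g') ((postcomposing a b c).map ψ)
  /-- the two isomorphisms `𝟬 ≅ 𝟬 ≫ 𝟬` coincide -/
  null_null (a b c : B) :
    Functor.LaxMonoidal.ε (precomp c (𝟬 : a ⟶ b)) = Functor.LaxMonoidal.ε (postcomp a (𝟬 : b ⟶ c))
  /-- the isomorphism `f ≫ - ⊞ f' ≫ - ≅ (f ⊞ f') ≫ -` respects units,
  equivalently `𝟬 ≅ - ≫ 𝟬` respects sums -/
  sum_null {a b : B} (c : B) (f f' : a ⟶ b) :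
    (MonoidalCategoryStruct.leftUnitor (𝟬 : a ⟶ c)).hom ≫ Functor.LaxMonoidal.ε (precomp c (f ⊞ f')) =
      (Functor.LaxMonoidal.ε (precomp c f) ⊞ₘ Functor.LaxMonoidal.ε (precomp c f')) ≫ Functor.LaxMonoidal.μ (postcomp a (𝟬 : b ⟶ c)) f f'
  /-- the isomorphism `- ≫ g ⊞ - ≫ g' ≅ - ≫ (g ⊞ g')` respects units,
  equivalently `𝟬 ≅ 𝟬 ≫ -` respects sums -/
  null_sum (a : B) {b c : B} (g g' : b ⟶ c) :
    (MonoidalCategoryStruct.leftUnitor (𝟬 : a ⟶ c)).hom ≫ Functor.LaxMonoidal.ε (postcomp a (g ⊞ g')) =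
      (Functor.LaxMonoidal.ε (postcomp a g) ⊞ₘ Functor.LaxMonoidal.ε (postcomp a g')) ≫ Functor.LaxMonoidal.μ (precomp c (𝟬 : a ⟶ b)) g g'
  /-- the two ways of expanding `(f ⊞ f') ≫ (g ⊞ g')` agree, up to the exchange `tensorμ` of the
  two middle summands -/
  sum_sum {a b c : B} (f f' : a ⟶ b) (g g' : b ⟶ c) :
    (Functor.LaxMonoidal.μ (precomp c f) g g' ⊞ₘ Functor.LaxMonoidal.μ (precomp c f') g g') ≫ Functor.LaxMonoidal.μ (postcomp a (g ⊞ g')) f f' =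
      MonoidalCategory.tensorμ (f ≫ g) (f ≫ g') (f' ≫ g) (f' ≫ g') ≫
        (Functor.LaxMonoidal.μ (postcomp a g) f f' ⊞ₘ Functor.LaxMonoidal.μ (postcomp a g') f f') ≫ Functor.LaxMonoidal.μ (precomp c (f ⊞ f')) g g'
  /-- the associator is monoidal in its first variable -/
  associator_left (a : B) {b c d : B} (g : b ⟶ c) (h : c ⟶ d) :
    NatTrans.IsMonoidal (F₁ := postcomp a g ⋙ postcomp a h) (F₂ := postcomp a (g ≫ h))
      (associatorNatIsoLeft a g h).hom
  /-- the associator is monoidal in its second variable -/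
  associator_middle {a b c d : B} (f : a ⟶ b) (h : c ⟶ d) :
    NatTrans.IsMonoidal (F₁ := precomp c f ⋙ postcomp a h) (F₂ := postcomp b h ⋙ precomp d f)
      (associatorNatIsoMiddle f h).hom
  /-- the associator is monoidal in its third variable -/
  associator_right {a b c : B} (f : a ⟶ b) (g : b ⟶ c) (d : B) :
    NatTrans.IsMonoidal (F₁ := precomp d (f ≫ g)) (F₂ := precomp d g ⋙ precomp d f)
      (associatorNatIsoRight f g d).hom
  /-- the left unitor is monoidal -/
  leftUnitor (a b : B) :
    NatTrans.IsMonoidal (F₁ := precomp b (𝟙 a)) (F₂ := 𝟭 (a ⟶ b)) (leftUnitorNatIso a b).hom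
  /-- the right unitor is monoidal -/
  rightUnitor (a b : B) :
    NatTrans.IsMonoidal (F₁ := postcomp a (𝟙 b)) (F₂ := 𝟭 (a ⟶ b)) (rightUnitorNatIso a b).hom

attribute [reducible, instance] SMCCategory.monoidal SMCCategory.symmetric SMCCategory.precompBraided
  SMCCategory.postcompBraided

namespace SMCCategory
section
variable {B : Type u} [Bicategory.{w, v} B] [SMCCategory B] {a b c d : B}

/-- Left distributivity. -/
def distribL (f : a ⟶ b) (g g' : b ⟶ c) : (f ≫ g) ⊞ (f ≫ g') ≅ f ≫ (g ⊞ g') :=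
  Functor.Monoidal.μIso (precomp c f) g g'

/-- Right distributivity. -/
def distribR (f f' : a ⟶ b) (g : b ⟶ c) : (f ≫ g) ⊞ (f' ≫ g) ≅ (f ⊞ f') ≫ g :=
  Functor.Monoidal.μIso (postcomp a g) f f'

/-- The zero `1`-cell is right absorbing. -/
def nullL (f : a ⟶ b) (c : B) : (𝟬 : a ⟶ c) ≅ f ≫ (𝟬 : b ⟶ c) :=
  Functor.Monoidal.εIso (precomp c f)

/-- The zero `1`-cell is left absorbing. -/
def nullR (a : B) (g : b ⟶ c) : (𝟬 : a ⟶ c) ≅ (𝟬 : a ⟶ b) ≫ g :=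
  Functor.Monoidal.εIso (postcomp a g)

lemma distribL_naturality (f : a ⟶ b) {g g' h h' : b ⟶ c} (α : g ⟶ h) (β : g' ⟶ h') :
    (distribL f g g').hom ≫ f ◁ (α ⊞ₘ β) = (f ◁ α ⊞ₘ f ◁ β) ≫ (distribL f h h').hom :=
  (Functor.LaxMonoidal.μ_natural (precomp c f) α β).symm

lemma distribL_whisker {f f' : a ⟶ b} (φ : f ⟶ f') (g g' : b ⟶ c) :
    (distribL f g g').hom ≫ φ ▷ (g ⊞ g') = (φ ▷ g ⊞ₘ φ ▷ g') ≫ (distribL f' g g').hom :=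
  (precomp_natural c φ).tensor g g'

lemma distribR_naturality {f f' h h' : a ⟶ b} (α : f ⟶ h) (β : f' ⟶ h') (g : b ⟶ c) :
    (distribR f f' g).hom ≫ (α ⊞ₘ β) ▷ g = (α ▷ g ⊞ₘ β ▷ g) ≫ (distribR h h' g).hom :=
  (Functor.LaxMonoidal.μ_natural (postcomp a g) α β).symm

lemma distribR_whisker (f f' : a ⟶ b) {g g' : b ⟶ c} (ψ : g ⟶ g') :
    (distribR f f' g).hom ≫ (f ⊞ f') ◁ ψ = (f ◁ ψ ⊞ₘ f' ◁ ψ) ≫ (distribR f f' g').hom :=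
  (postcomp_natural a ψ).tensor f f'

lemma nullL_whisker {f f' : a ⟶ b} (φ : f ⟶ f') (c : B) :
    (nullL f c).hom ≫ φ ▷ 𝟬 = (nullL f' c).hom :=
  (precomp_natural c φ).unit

lemma nullR_whisker (a : B) {g g' : b ⟶ c} (ψ : g ⟶ g') :
    (nullR a g).hom ≫ 𝟬 ◁ ψ = (nullR a g').hom :=
  (postcomp_natural a ψ).unit

lemma distribR_associator (f f' : a ⟶ b) (g : b ⟶ c) (h : c ⟶ d) :
    (distribR (f ≫ g) (f' ≫ g) h).hom ≫ (distribR f f' g).hom ▷ h ≫ (α_ (f ⊞ f') g h).hom =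
      ((α_ f g h).hom ⊞ₘ (α_ f' g h).hom) ≫ (distribR f f' (g ≫ h)).hom := by
  exact (Category.assoc _ _ _).symm.trans ((associator_left a g h).tensor f f')

lemma distrib_associator (f : a ⟶ b) (g g' : b ⟶ c) (h : c ⟶ d) :
    (distribR (f ≫ g) (f ≫ g') h).hom ≫ (distribL f g g').hom ▷ h ≫ (α_ f (g ⊞ g') h).hom =
      ((α_ f g h).hom ⊞ₘ (α_ f g' h).hom) ≫ (distribL f (g ≫ h) (g' ≫ h)).hom ≫
        f ◁ (distribR g g' h).hom := by
  exact (Category.assoc _ _ _).symm.trans ((associator_middle f h).tensor g g')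

lemma distribL_associator (f : a ⟶ b) (g : b ⟶ c) (h h' : c ⟶ d) :
    (distribL (f ≫ g) h h').hom ≫ (α_ f g (h ⊞ h')).hom =
      ((α_ f g h).hom ⊞ₘ (α_ f g h').hom) ≫ (distribL f (g ≫ h) (g ≫ h')).hom ≫
        f ◁ (distribL g h h').hom := by
  exact (associator_right f g d).tensor h h'

lemma distribL_leftUnitor (f f' : a ⟶ b) :
    (distribL (𝟙 a) f f').hom ≫ (λ_ (f ⊞ f')).hom = ((λ_ f).hom ⊞ₘ (λ_ f').hom) := by
  exact ((leftUnitor a b).tensor f f').trans (Category.comp_id _)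

lemma distribR_rightUnitor (f f' : a ⟶ b) :
    (distribR f f' (𝟙 b)).hom ≫ (ρ_ (f ⊞ f')).hom = ((ρ_ f).hom ⊞ₘ (ρ_ f').hom) := by
  exact ((rightUnitor a b).tensor f f').trans (Category.comp_id _)

lemma nullR_associator (a : B) (g : b ⟶ c) (h : c ⟶ d) :
    (nullR a h).hom ≫ (nullR a g).hom ▷ h ≫ (α_ 𝟬 g h).hom = (nullR a (g ≫ h)).hom := by
  exact (Category.assoc _ _ _).symm.trans (associator_left a g h).unit

lemma null_associator (f : a ⟶ b) (h : c ⟶ d) :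
    (nullR a h).hom ≫ (nullL f c).hom ▷ h ≫ (α_ f 𝟬 h).hom =
      (nullL f d).hom ≫ f ◁ (nullR b h).hom := by
  exact (Category.assoc _ _ _).symm.trans (associator_middle f h).unit

lemma nullL_associator (f : a ⟶ b) (g : b ⟶ c) (d : B) :
    (nullL (f ≫ g) d).hom ≫ (α_ f g 𝟬).hom = (nullL f d).hom ≫ f ◁ (nullL g d).hom := by
  exact (associator_right f g d).unit

lemma nullL_leftUnitor (a b : B) :
    (nullL (𝟙 a) b).hom ≫ (λ_ 𝟬).hom = 𝟙 (𝟬 : a ⟶ b) :=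
  (leftUnitor a b).unit

lemma nullR_rightUnitor (a b : B) :
    (nullR a (𝟙 b)).hom ≫ (ρ_ 𝟬).hom = 𝟙 (𝟬 : a ⟶ b) :=
  (rightUnitor a b).unit

lemma nullL_eq_nullR (a b c : B) :
    nullL (𝟬 : a ⟶ b) c = nullR a (𝟬 : b ⟶ c) := Iso.ext (null_null a b c)

lemma distribR_comp (f f' : a ⟶ b) (g : b ⟶ c) (h : c ⟶ d) :
    (distribR f f' (g ≫ h)).hom = ((α_ f g h).inv ⊞ₘ (α_ f' g h).inv) ≫
      (distribR (f ≫ g) (f' ≫ g) h).hom ≫ (distribR f f' g).hom ▷ h ≫ (α_ (f ⊞ f') g h).hom := by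
  rw [distribR_associator, MonoidalCategory.tensorHom_comp_tensorHom_assoc]
  simp

lemma distribL_comp (f : a ⟶ b) (g : b ⟶ c) (h h' : c ⟶ d) :
    (distribL (f ≫ g) h h').hom = ((α_ f g h).hom ⊞ₘ (α_ f g h').hom) ≫
      (distribL f (g ≫ h) (g ≫ h')).hom ≫ f ◁ (distribL g h h').hom ≫
        (α_ f g (h ⊞ h')).inv := by
  rw [← cancel_mono (α_ f g (h ⊞ h')).hom, distribL_associator]
  simp

lemma distrib_comp (f : a ⟶ b) (g g' : b ⟶ c) (h : c ⟶ d) :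
    (distribR (f ≫ g) (f ≫ g') h).hom ≫ (distribL f g g').hom ▷ h =
      ((α_ f g h).hom ⊞ₘ (α_ f g' h).hom) ≫ (distribL f (g ≫ h) (g' ≫ h)).hom ≫
        f ◁ (distribR g g' h).hom ≫ (α_ f (g ⊞ g') h).inv := by
  rw [← cancel_mono (α_ f (g ⊞ g') h).hom, Category.assoc, distrib_associator]
  simp

lemma distrib_comp_inv (f : a ⟶ b) (g g' : b ⟶ c) (h : c ⟶ d) :
    (distribL f (g ≫ h) (g' ≫ h)).hom ≫ f ◁ (distribR g g' h).hom ≫ (α_ f (g ⊞ g') h).inv =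
      ((α_ f g h).inv ⊞ₘ (α_ f g' h).inv) ≫
        (distribR (f ≫ g) (f ≫ g') h).hom ≫ (distribL f g g').hom ▷ h := by
  rw [distrib_comp, MonoidalCategory.tensorHom_comp_tensorHom_assoc]
  simp

lemma distribL_comp_inv (f : a ⟶ b) (g : b ⟶ c) (h h' : c ⟶ d) :
    (distribL f (g ≫ h) (g ≫ h')).hom ≫ f ◁ (distribL g h h').hom ≫ (α_ f g (h ⊞ h')).inv =
      ((α_ f g h).inv ⊞ₘ (α_ f g h').inv) ≫ (distribL (f ≫ g) h h').hom := by
  rw [distribL_comp, MonoidalCategory.tensorHom_comp_tensorHom_assoc]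
  simp

lemma nullR_comp (a : B) (g : b ⟶ c) (h : c ⟶ d) :
    (nullR a (g ≫ h)).hom = (nullR a h).hom ≫ (nullR a g).hom ▷ h ≫ (α_ 𝟬 g h).hom :=
  (nullR_associator a g h).symm

lemma nullL_comp (f : a ⟶ b) (g : b ⟶ c) (d : B) :
    (nullL (f ≫ g) d).hom =
      (nullL f d).hom ≫ f ◁ (nullL g d).hom ≫ (α_ f g 𝟬).inv := by
  rw [← cancel_mono (α_ f g 𝟬).hom, nullL_associator]
  simp

lemma null_comp (f : a ⟶ b) (h : c ⟶ d) :
    (nullR a h).hom ≫ (nullL f c).hom ▷ h =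
      (nullL f d).hom ≫ f ◁ (nullR b h).hom ≫ (α_ f 𝟬 h).inv := by
  rw [← cancel_mono (α_ f 𝟬 h).hom, Category.assoc, null_associator]
  simp

lemma sum_nullL (f f' : a ⟶ b) (c : B) :
    (MonoidalCategoryStruct.leftUnitor (𝟬 : a ⟶ c)).hom ≫ (nullL (f ⊞ f') c).hom =
      ((nullL f c).hom ⊞ₘ (nullL f' c).hom) ≫ (distribR f f' 𝟬).hom :=
  sum_null c f f'

lemma sum_nullR (a : B) (g g' : b ⟶ c) :
    (MonoidalCategoryStruct.leftUnitor (𝟬 : a ⟶ c)).hom ≫ (nullR a (g ⊞ g')).hom =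
      ((nullR a g).hom ⊞ₘ (nullR a g').hom) ≫ (distribL 𝟬 g g').hom :=
  null_sum a g g'

lemma interchange (f f' : a ⟶ b) (g g' : b ⟶ c) :
    ((distribL f g g').hom ⊞ₘ (distribL f' g g').hom) ≫ (distribR f f' (g ⊞ g')).hom =
      MonoidalCategory.tensorμ (f ≫ g) (f ≫ g') (f' ≫ g) (f' ≫ g') ≫
        ((distribR f f' g).hom ⊞ₘ (distribR f f' g').hom) ≫ (distribL (f ⊞ f') g g').hom :=
  sum_sum f f' g g'

/-- In a symmetric monoidal category the exchange of the middle summands is an involution. -/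
lemma tensorμ_tensorμ {X : Type u} [Category.{v} X] [MonoidalCategory X] [SymmetricCategory X]
    (x y z t : X) :
    MonoidalCategory.tensorμ x y z t ≫ MonoidalCategory.tensorμ x z y t = 𝟙 _ := by
  rw [← MonoidalCategory.tensorμ_tensorδ x y z t]
  congr 1
  simp [MonoidalCategory.tensorμ, MonoidalCategory.tensorδ,
    SymmetricCategory.braiding_swap_eq_inv_braiding]

lemma interchange_symm (f f' : a ⟶ b) (g g' : b ⟶ c) :
    ((distribR f f' g).hom ⊞ₘ (distribR f f' g').hom) ≫ (distribL (f ⊞ f') g g').hom =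
      MonoidalCategory.tensorμ (f ≫ g) (f' ≫ g) (f ≫ g') (f' ≫ g') ≫
        ((distribL f g g').hom ⊞ₘ (distribL f' g g').hom) ≫ (distribR f f' (g ⊞ g')).hom := by
  rw [interchange, ← Category.assoc (MonoidalCategory.tensorμ _ _ _ _), tensorμ_tensorμ,
    Category.id_comp]
end
end SMCCategory

section
variable {B : Type u₁} [Bicategory.{w₁, v₁} B] {C : Type u₂} [Bicategory.{w₂, v₂} C]
  {D : Type u₃} [Bicategory.{w₃, v₃} D]

/-- The compositors of a pseudofunctor `F`, as a transformation natural in the second `1`-cell. -/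
@[simps]
def CategoryTheory.Pseudofunctor.mapCompNatRight (F : B ⥤ᵖ C) {a b : B} (f : a ⟶ b) (c : B) :
    precomp c f ⋙ F.mapFunctor a c ⟶ F.mapFunctor b c ⋙ precomp (F.obj c) (F.map f) where
  app g := (F.mapComp f g).hom
  naturality g g' ψ := by
    change F.map₂ (f ◁ ψ) ≫ _ = _ ≫ F.map f ◁ F.map₂ ψ
    simp

/-- The compositors of a pseudofunctor `F`, as a transformation natural in the first `1`-cell. -/
@[simps]
def CategoryTheory.Pseudofunctor.mapCompNatLeft (F : B ⥤ᵖ C) (a : B) {b c : B} (g : b ⟶ c) :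
    postcomp a g ⋙ F.mapFunctor a c ⟶ F.mapFunctor a b ⋙ postcomp (F.obj a) (F.map g) where
  app f := (F.mapComp f g).hom
  naturality f f' φ := by
    change F.map₂ (φ ▷ g) ≫ _ = _ ≫ F.map₂ φ ▷ F.map g
    simp

/-- The `2`-cells of a strong transformation `η`, as a natural transformation. -/
@[simps]
def CategoryTheory.Pseudofunctor.StrongTrans.nat {F G : B ⥤ᵖ C} (η : F.StrongTrans G) (a b : B) :
    F.mapFunctor a b ⋙ postcomp (F.obj a) (η.app b) ⟶
      G.mapFunctor a b ⋙ precomp (G.obj b) (η.app a) where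
  app f := (η.naturality f).hom
  naturality _ _ φ := η.naturality_naturality φ

end

/-- An SMC-functor: a pseudofunctor whose action on each hom-category is symmetric strong
monoidal, and whose compositors `F (f ≫ g) ≅ F f ≫ F g` are monoidal in `g` and in `f`. -/
structure SMCFunctor (B : Type u₁) [Bicategory.{w₁, v₁} B] [SMCCategory B]
    (C : Type u₂) [Bicategory.{w₂, v₂} C] [SMCCategory C] extends B ⥤ᵖ C where
  braided (a b : B) : (toPseudofunctor.mapFunctor a b).Braided
  mapComp_right {a b : B} (f : a ⟶ b) (c : B) :
    NatTrans.IsMonoidal (toPseudofunctor.mapCompNatRight f c)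
  mapComp_left (a : B) {b c : B} (g : b ⟶ c) :
    NatTrans.IsMonoidal (toPseudofunctor.mapCompNatLeft a g)

attribute [instance] SMCFunctor.braided

/-- The constructor of `NatTrans.IsMonoidal`, with the monoidal structures found by unification. -/
lemma SMCFunctor.isMonoidal_mk {X : Type u₁} [Category.{v₁} X] [MonoidalCategory X]
    {Y : Type u₂} [Category.{v₂} Y] [MonoidalCategory Y] {P Q : X ⥤ Y}
    {iP : P.LaxMonoidal} {iQ : Q.LaxMonoidal} {τ : P ⟶ Q}
    (unit : iP.ε ≫ τ.app 𝟬 = iQ.ε)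
    (tensor : ∀ x y, iP.μ x y ≫ τ.app (x ⊞ y) = (τ.app x ⊞ₘ τ.app y) ≫ iQ.μ x y) :
    NatTrans.IsMonoidal τ := ⟨unit, tensor⟩

namespace SMCFunctor
section
variable {B : Type u₁} [Bicategory.{w₁, v₁} B] [SMCCategory B]
  {C : Type u₂} [Bicategory.{w₂, v₂} C] [SMCCategory C]
  {D : Type u₃} [Bicategory.{w₃, v₃} D] [SMCCategory D]

/-- `F f ⊞ F g ≅ F (f ⊞ g)`. -/
def mapSum (F : SMCFunctor B C) {a b : B} (f g : a ⟶ b) : F.map f ⊞ F.map g ≅ F.map (f ⊞ g) :=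
  Functor.Monoidal.μIso (F.mapFunctor a b) f g

/-- `𝟬 ≅ F 𝟬`. -/
def mapZero (F : SMCFunctor B C) (a b : B) : 𝟬 ≅ F.map (𝟬 : a ⟶ b) :=
  Functor.Monoidal.εIso (F.mapFunctor a b)

open SMCCategory

lemma mapSum_naturality (F : SMCFunctor B C) {a b : B} {f g f' g' : a ⟶ b}
    (α : f ⟶ f') (β : g ⟶ g') :
    (F.mapSum f g).hom ≫ F.map₂ (α ⊞ₘ β) = (F.map₂ α ⊞ₘ F.map₂ β) ≫ (F.mapSum f' g').hom :=
  (Functor.LaxMonoidal.μ_natural (F.mapFunctor a b) α β).symm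

lemma mapSum_distribL (F : SMCFunctor B C) {a b c : B} (f : a ⟶ b) (g g' : b ⟶ c) :
    (F.mapSum (f ≫ g) (f ≫ g')).hom ≫ F.map₂ (distribL f g g').hom ≫
        (F.mapComp f (g ⊞ g')).hom =
      ((F.mapComp f g).hom ⊞ₘ (F.mapComp f g').hom) ≫
        (distribL (F.map f) (F.map g) (F.map g')).hom ≫ F.map f ◁ (F.mapSum g g').hom :=
  (Category.assoc _ _ _).symm.trans ((F.mapComp_right f c).tensor g g')

lemma mapSum_distribR (F : SMCFunctor B C) {a b c : B} (f f' : a ⟶ b) (g : b ⟶ c) :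
    (F.mapSum (f ≫ g) (f' ≫ g)).hom ≫ F.map₂ (distribR f f' g).hom ≫
        (F.mapComp (f ⊞ f') g).hom =
      ((F.mapComp f g).hom ⊞ₘ (F.mapComp f' g).hom) ≫
        (distribR (F.map f) (F.map f') (F.map g)).hom ≫ (F.mapSum f f').hom ▷ F.map g :=
  (Category.assoc _ _ _).symm.trans ((F.mapComp_left a g).tensor f f')

lemma mapZero_nullL (F : SMCFunctor B C) {a b : B} (f : a ⟶ b) (c : B) :
    (F.mapZero a c).hom ≫ F.map₂ (nullL f c).hom ≫ (F.mapComp f 𝟬).hom =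
      (nullL (F.map f) (F.obj c)).hom ≫ F.map f ◁ (F.mapZero b c).hom :=
  (Category.assoc _ _ _).symm.trans (F.mapComp_right f c).unit

lemma mapZero_nullR (F : SMCFunctor B C) (a : B) {b c : B} (g : b ⟶ c) :
    (F.mapZero a c).hom ≫ F.map₂ (nullR a g).hom ≫ (F.mapComp 𝟬 g).hom =
      (nullR (F.obj a) (F.map g)).hom ≫ (F.mapZero a b).hom ▷ F.map g :=
  (Category.assoc _ _ _).symm.trans (F.mapComp_left a g).unit

/-- The identity functor is symmetric strong monoidal on hom-categories. -/
@[reducible]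
def idBraided {B : Type u₁} [Bicategory.{w₁, v₁} B] [SMCCategory B] (a b : B) :
    ((Pseudofunctor.id B).mapFunctor a b).Braided :=
  (inferInstance : (𝟭 (a ⟶ b)).Braided)

/-- The symmetric strong monoidal structure of a composite on hom-categories. -/
@[reducible]
def compBraided (F : SMCFunctor B C) (G : SMCFunctor C D) (a b : B) :
    ((F.toPseudofunctor.comp G.toPseudofunctor).mapFunctor a b).Braided :=
  (inferInstance : (F.mapFunctor a b ⋙ G.mapFunctor (F.obj a) (F.obj b)).Braided)

variable (B) in
/-- The identity SMC-functor. -/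
def id : SMCFunctor B B where
  toPseudofunctor := Pseudofunctor.id B
  braided := idBraided
  mapComp_right f c := by
    apply isMonoidal_mk
    · change (𝟙 _ ≫ (nullL f c).hom) ≫ 𝟙 _ = (nullL f c).hom ≫ f ◁ 𝟙 _
      simp
    · intro g g'
      change (𝟙 _ ≫ (distribL f g g').hom) ≫ 𝟙 _ =
        (𝟙 _ ⊞ₘ 𝟙 _) ≫ (distribL f g g').hom ≫ f ◁ 𝟙 _
      simp
  mapComp_left a _ c g := by
    apply isMonoidal_mk
    · change (𝟙 _ ≫ (nullR a g).hom) ≫ 𝟙 _ = (nullR a g).hom ≫ 𝟙 _ ▷ g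
      simp
    · intro f f'
      change (𝟙 _ ≫ (distribR f f' g).hom) ≫ 𝟙 _ =
        (𝟙 _ ⊞ₘ 𝟙 _) ≫ (distribR f f' g).hom ≫ 𝟙 _ ▷ g
      simp

/-- Composition of SMC-functors, in diagrammatic order: first `F`, then `G`. -/
def comp (F : SMCFunctor B C) (G : SMCFunctor C D) : SMCFunctor B D where
  toPseudofunctor := F.toPseudofunctor.comp G.toPseudofunctor
  braided := compBraided F G
  mapComp_right {a b} f c := by
    apply isMonoidal_mk
    · change (((G.mapZero _ _).hom ≫ G.map₂ (F.mapZero a c).hom) ≫ G.map₂ (F.map₂ (nullL f c).hom)) ≫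
        G.map₂ (F.mapComp f 𝟬).hom ≫ (G.mapComp (F.map f) (F.map 𝟬)).hom =
        (nullL (G.map (F.map f)) (G.obj (F.obj c))).hom ≫ G.map (F.map f) ◁ ((G.mapZero _ _).hom ≫ G.map₂ (F.mapZero b c).hom)
      rw [Bicategory.whiskerLeft_comp, ← reassoc_of% G.mapZero_nullL]
      simp only [Category.assoc]
      rw [← G.map₂_comp_assoc, ← G.map₂_comp_assoc]
      simp only [Category.assoc]
      rw [F.mapZero_nullL]
      simp
    · intro g g'
      change (((G.mapSum _ _).hom ≫ G.map₂ (F.mapSum (f ≫ g) (f ≫ g')).hom) ≫ G.map₂ (F.map₂ (distribL f g g').hom)) ≫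
        G.map₂ (F.mapComp f (g ⊞ g')).hom ≫ (G.mapComp (F.map f) (F.map (g ⊞ g'))).hom =
        ((G.map₂ (F.mapComp f g).hom ≫ (G.mapComp (F.map f) (F.map g)).hom) ⊞ₘ
          (G.map₂ (F.mapComp f g').hom ≫ (G.mapComp (F.map f) (F.map g')).hom)) ≫
        (distribL (G.map (F.map f)) (G.map (F.map g)) (G.map (F.map g'))).hom ≫ G.map (F.map f) ◁ ((G.mapSum _ _).hom ≫ G.map₂ (F.mapSum g g').hom)
      rw [Bicategory.whiskerLeft_comp, ← MonoidalCategory.tensorHom_comp_tensorHom]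
      simp only [Category.assoc]
      rw [← reassoc_of% G.mapSum_distribL]
      rw [← G.map₂_comp_assoc, ← G.map₂_comp_assoc]
      simp only [Category.assoc]
      rw [F.mapSum_distribL]
      simp [reassoc_of% G.mapSum_naturality]
  mapComp_left a b c g := by
    apply isMonoidal_mk
    · change (((G.mapZero _ _).hom ≫ G.map₂ (F.mapZero a c).hom) ≫
          G.map₂ (F.map₂ (nullR a g).hom)) ≫
        G.map₂ (F.mapComp 𝟬 g).hom ≫ (G.mapComp (F.map 𝟬) (F.map g)).hom =
        (nullR (G.obj (F.obj a)) (G.map (F.map g))).hom ≫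
          ((G.mapZero _ _).hom ≫ G.map₂ (F.mapZero a b).hom) ▷ G.map (F.map g)
      rw [Bicategory.comp_whiskerRight, ← reassoc_of% G.mapZero_nullR]
      simp only [Category.assoc]
      rw [← G.map₂_comp_assoc, ← G.map₂_comp_assoc]
      simp only [Category.assoc]
      rw [F.mapZero_nullR]
      simp
    · intro f f'
      change (((G.mapSum _ _).hom ≫ G.map₂ (F.mapSum (f ≫ g) (f' ≫ g)).hom) ≫
          G.map₂ (F.map₂ (distribR f f' g).hom)) ≫
        G.map₂ (F.mapComp (f ⊞ f') g).hom ≫ (G.mapComp (F.map (f ⊞ f')) (F.map g)).hom =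
        ((G.map₂ (F.mapComp f g).hom ≫ (G.mapComp (F.map f) (F.map g)).hom) ⊞ₘ
          (G.map₂ (F.mapComp f' g).hom ≫ (G.mapComp (F.map f') (F.map g)).hom)) ≫
        (distribR (G.map (F.map f)) (G.map (F.map f')) (G.map (F.map g))).hom ≫
          ((G.mapSum _ _).hom ≫ G.map₂ (F.mapSum f f').hom) ▷ G.map (F.map g)
      rw [Bicategory.comp_whiskerRight, ← MonoidalCategory.tensorHom_comp_tensorHom]
      simp only [Category.assoc]
      rw [← reassoc_of% G.mapSum_distribR]
      rw [← G.map₂_comp_assoc, ← G.map₂_comp_assoc]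
      simp only [Category.assoc]
      rw [F.mapSum_distribR]
      simp [reassoc_of% G.mapSum_naturality]

end
end SMCFunctor

open SMCCategory

/-- A strong monoidal transformation of SMC-functors: a strong transformation of the underlying
pseudofunctors whose `2`-cells `F f ≫ η b ≅ η a ≫ G f` form, for all `a` and `b`, a monoidal
natural transformation in `f : a ⟶ b`. -/
structure MonoidalTrans {B : Type u₁} [Bicategory.{w₁, v₁} B] [SMCCategory B]
    {C : Type u₂} [Bicategory.{w₂, v₂} C] [SMCCategory C] (F G : SMCFunctor B C) extends
    F.toPseudofunctor.StrongTrans G.toPseudofunctor where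
  isMonoidal (a b : B) : NatTrans.IsMonoidal (toStrongTrans.nat a b)

namespace MonoidalTrans
section
variable {B : Type u₁} [Bicategory.{w₁, v₁} B] [SMCCategory B]
  {C : Type u₂} [Bicategory.{w₂, v₂} C] [SMCCategory C]
  {D : Type u₃} [Bicategory.{w₃, v₃} D] [SMCCategory D] {F G H : SMCFunctor B C}

lemma naturality_sum (η : MonoidalTrans F G) {a b : B} (f g : a ⟶ b) :
    (distribR (F.map f) (F.map g) (η.app b)).hom ≫ (F.mapSum f g).hom ▷ η.app b ≫
        (η.naturality (f ⊞ g)).hom =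
      ((η.naturality f).hom ⊞ₘ (η.naturality g).hom) ≫
        (distribL (η.app a) (G.map f) (G.map g)).hom ≫ η.app a ◁ (G.mapSum f g).hom :=
  (Category.assoc _ _ _).symm.trans ((η.isMonoidal a b).tensor f g)

lemma naturality_zero (η : MonoidalTrans F G) (a b : B) :
    (nullR (F.obj a) (η.app b)).hom ≫ (F.mapZero a b).hom ▷ η.app b ≫
        (η.naturality 𝟬).hom =
      (nullL (η.app a) (G.obj b)).hom ≫ η.app a ◁ (G.mapZero a b).hom :=
  (Category.assoc _ _ _).symm.trans (η.isMonoidal a b).unit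

open scoped Pseudofunctor.StrongTrans

/-- The underlying strong transformation. -/
abbrev hom (η : MonoidalTrans F G) : F.toPseudofunctor ⟶ G.toPseudofunctor := η.toStrongTrans

/-- The condition of being monoidal, spelled out. -/
lemma isMonoidal_of {η : F.toPseudofunctor ⟶ G.toPseudofunctor}
    (zero : ∀ a b : B, (nullR (F.obj a) (η.app b)).hom ≫ (F.mapZero a b).hom ▷ η.app b ≫
        (η.naturality 𝟬).hom =
      (nullL (η.app a) (G.obj b)).hom ≫ η.app a ◁ (G.mapZero a b).hom)
    (sum : ∀ {a b : B} (f g : a ⟶ b),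
      (distribR (F.map f) (F.map g) (η.app b)).hom ≫ (F.mapSum f g).hom ▷ η.app b ≫
        (η.naturality (f ⊞ g)).hom =
      ((η.naturality f).hom ⊞ₘ (η.naturality g).hom) ≫
        (distribL (η.app a) (G.map f) (G.map g)).hom ≫ η.app a ◁ (G.mapSum f g).hom)
    (a b : B) : NatTrans.IsMonoidal (Pseudofunctor.StrongTrans.nat η a b) :=
  ⟨(Category.assoc _ _ _).trans (zero a b), fun f g => (Category.assoc _ _ _).trans (sum f g)⟩

variable (F) in
/-- The identity transformation. -/
def id : MonoidalTrans F F where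
  toStrongTrans := 𝟙 F.toPseudofunctor
  isMonoidal := isMonoidal_of
    (fun a b => by
      change (nullR (F.obj a) (𝟙 (F.obj b))).hom ≫ (F.mapZero a b).hom ▷ 𝟙 (F.obj b) ≫
          (ρ_ (F.map 𝟬)).hom ≫ (λ_ (F.map 𝟬)).inv =
        (nullL (𝟙 (F.obj a)) (F.obj b)).hom ≫ 𝟙 (F.obj a) ◁ (F.mapZero a b).hom
      rw [← cancel_mono (λ_ _).hom]
      simp [reassoc_of% nullL_leftUnitor, reassoc_of% nullR_rightUnitor])
    (fun {a b} f g => by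
      change (distribR (F.map f) (F.map g) (𝟙 (F.obj b))).hom ≫
          (F.mapSum f g).hom ▷ 𝟙 (F.obj b) ≫ (ρ_ (F.map (f ⊞ g))).hom ≫ (λ_ (F.map (f ⊞ g))).inv =
        (((ρ_ (F.map f)).hom ≫ (λ_ (F.map f)).inv) ⊞ₘ ((ρ_ (F.map g)).hom ≫ (λ_ (F.map g)).inv)) ≫
          (distribL (𝟙 (F.obj a)) (F.map f) (F.map g)).hom ≫ 𝟙 (F.obj a) ◁ (F.mapSum f g).hom
      rw [← cancel_mono (λ_ _).hom]
      simp [reassoc_of% distribR_rightUnitor, reassoc_of% distribL_leftUnitor,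
        MonoidalCategory.tensorHom_comp_tensorHom_assoc])

/-- Composition of transformations, in diagrammatic order. -/
def comp (η : MonoidalTrans F G) (θ : MonoidalTrans G H) : MonoidalTrans F H where
  toStrongTrans := η.hom ≫ θ.hom
  isMonoidal := isMonoidal_of
    (fun a b => by
      change (nullR (F.obj a) (η.app b ≫ θ.app b)).hom ≫
          (F.mapZero a b).hom ▷ (η.app b ≫ θ.app b) ≫
          (α_ _ _ _).inv ≫ (η.naturality 𝟬).hom ▷ θ.app b ≫ (α_ _ _ _).hom ≫
            η.app a ◁ (θ.naturality 𝟬).hom ≫ (α_ _ _ _).inv =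
        (nullL (η.app a ≫ θ.app a) (H.obj b)).hom ≫ (η.app a ≫ θ.app a) ◁ (H.mapZero a b).hom
      have h₁ := congrArg (· ▷ θ.app b) (η.naturality_zero a b)
      have h₂ := congrArg (η.app a ◁ ·) (θ.naturality_zero a b)
      simp only [comp_whiskerRight, whiskerLeft_comp] at h₁ h₂
      simp only [nullR_comp, nullL_comp, whiskerRight_comp, comp_whiskerLeft,
        Category.assoc, Iso.hom_inv_id_assoc, Iso.inv_hom_id_assoc, reassoc_of% h₁,
        reassoc_of% null_comp, whisker_assoc]
      rw [reassoc_of% h₂])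
    (fun {a b} f g => by
      change (distribR (F.map f) (F.map g) (η.app b ≫ θ.app b)).hom ≫
          (F.mapSum f g).hom ▷ (η.app b ≫ θ.app b) ≫
          (α_ _ _ _).inv ≫ (η.naturality (f ⊞ g)).hom ▷ θ.app b ≫ (α_ _ _ _).hom ≫
            η.app a ◁ (θ.naturality (f ⊞ g)).hom ≫ (α_ _ _ _).inv =
        (((α_ _ _ _).inv ≫ (η.naturality f).hom ▷ θ.app b ≫ (α_ _ _ _).hom ≫
            η.app a ◁ (θ.naturality f).hom ≫ (α_ _ _ _).inv) ⊞ₘ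
          ((α_ _ _ _).inv ≫ (η.naturality g).hom ▷ θ.app b ≫ (α_ _ _ _).hom ≫
            η.app a ◁ (θ.naturality g).hom ≫ (α_ _ _ _).inv)) ≫
        (distribL (η.app a ≫ θ.app a) (H.map f) (H.map g)).hom ≫
          (η.app a ≫ θ.app a) ◁ (H.mapSum f g).hom
      have h₁ := congrArg (· ▷ θ.app b) (η.naturality_sum f g)
      have h₂ := congrArg (η.app a ◁ ·) (θ.naturality_sum f g)
      simp only [comp_whiskerRight, whiskerLeft_comp] at h₁ h₂
      simp only [distribR_comp, distribL_comp, whiskerRight_comp,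
        comp_whiskerLeft, Category.assoc, Iso.hom_inv_id_assoc, Iso.inv_hom_id_assoc,
        reassoc_of% h₁, reassoc_of% distrib_comp, whisker_assoc,
        reassoc_of% distribR_naturality, ← MonoidalCategory.tensorHom_comp_tensorHom]
      rw [reassoc_of% h₂]
      simp only [reassoc_of% distribL_naturality]
      simp [MonoidalCategory.tensorHom_comp_tensorHom_assoc])

end
end MonoidalTrans

namespace MonoidalTrans
section
variable {B : Type u₁} [Bicategory.{w₁, v₁} B] [SMCCategory B]
  {C : Type u₂} [Bicategory.{w₂, v₂} C] [SMCCategory C]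
  {D : Type u₃} [Bicategory.{w₃, v₃} D] [SMCCategory D] {F G H : SMCFunctor B C}

variable (F G) in
/-- The zero transformation, with components `𝟬`. -/
def zeroStrong : F.toPseudofunctor.StrongTrans G.toPseudofunctor where
  app a := 𝟬
  naturality {a b} f := (nullL (F.map f) (G.obj b)).symm ≪≫ nullR (F.obj a) (G.map f)
  naturality_naturality φ := by
    rw [← cancel_epi (nullL _ _).hom]
    simp only [Iso.trans_hom, Iso.symm_hom, Category.assoc, Iso.hom_inv_id_assoc, nullR_whisker,
      reassoc_of% nullL_whisker]
  naturality_id a := by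
    rw [← cancel_epi (nullL _ _).hom, ← cancel_mono (ρ_ _).hom]
    simp only [Iso.trans_hom, Iso.symm_hom, Category.assoc, Iso.hom_inv_id_assoc, Iso.inv_hom_id,
      Category.comp_id, reassoc_of% nullR_whisker, nullR_rightUnitor, reassoc_of% nullL_whisker,
      nullL_leftUnitor]
  naturality_comp {a b c} f g := by
    rw [← cancel_epi (nullL _ _).hom]
    simp only [Iso.trans_hom, Iso.symm_hom, Category.assoc, Iso.hom_inv_id_assoc, nullR_whisker,
      reassoc_of% nullL_whisker, nullL_comp, nullR_comp, Iso.inv_hom_id_assoc, whiskerLeft_comp,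
      comp_whiskerRight, whiskerLeft_hom_inv_assoc, ← reassoc_of% null_comp,
      hom_inv_whiskerRight_assoc]

/-- The sum of two transformations: `(η ⊞ θ) a = η a ⊞ θ a`, with `2`-cells
`F f ≫ (η b ⊞ θ b) ≅ F f ≫ η b ⊞ F f ≫ θ b ≅ η a ≫ G f ⊞ θ a ≫ G f ≅ (η a ⊞ θ a) ≫ G f`. -/
def sumStrong (η θ : MonoidalTrans F G) : F.toPseudofunctor.StrongTrans G.toPseudofunctor where
  app a := η.app a ⊞ θ.app a
  naturality {a b} f := (distribL (F.map f) (η.app b) (θ.app b)).symm ≪≫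
    MonoidalCategory.tensorIso (η.naturality f) (θ.naturality f) ≪≫
    distribR (η.app a) (θ.app a) (G.map f)
  naturality_naturality φ := by
    rw [← cancel_epi (distribL _ _ _).hom]
    simp only [Iso.trans_hom, Iso.symm_hom, Category.assoc, Iso.hom_inv_id_assoc,
      reassoc_of% distribL_whisker, MonoidalCategory.tensorIso_hom,
      MonoidalCategory.tensorHom_comp_tensorHom_assoc, η.naturality_naturality,
      θ.naturality_naturality, distribR_whisker]
  naturality_id a := by
    rw [← cancel_epi (distribL _ _ _).hom, ← cancel_mono (ρ_ _).hom]
    simp only [Iso.trans_hom, Iso.symm_hom, Category.assoc, Iso.hom_inv_id_assoc, Iso.inv_hom_id,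
      Category.comp_id, reassoc_of% distribR_whisker, distribR_rightUnitor,
      reassoc_of% distribL_whisker, distribL_leftUnitor, MonoidalCategory.tensorIso_hom,
      MonoidalCategory.tensorHom_comp_tensorHom, reassoc_of% η.naturality_id, reassoc_of% θ.naturality_id]
  naturality_comp {a b c} f g := by
    rw [← cancel_epi (distribL _ _ _).hom]
    simp only [Iso.trans_hom, Iso.symm_hom, Category.assoc, Iso.hom_inv_id_assoc,
      distribR_whisker, MonoidalCategory.tensorIso_hom,
      MonoidalCategory.tensorHom_comp_tensorHom_assoc, η.naturality_comp, θ.naturality_comp]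
    simp only [← MonoidalCategory.tensorHom_comp_tensorHom, Category.assoc,
      reassoc_of% distribL_whisker, whiskerLeft_comp, comp_whiskerRight]
    simp only [distribL_comp, distribR_comp, Category.assoc, Iso.inv_hom_id_assoc,
      whiskerLeft_hom_inv_assoc, reassoc_of% distribL_naturality, reassoc_of% distrib_comp_inv,
      hom_inv_whiskerRight_assoc, reassoc_of% distribR_naturality]
    simp [MonoidalCategory.tensorHom_comp_tensorHom_assoc]

variable (F G) in
/-- The zero transformation is monoidal. -/
def zero : MonoidalTrans F G where
  toStrongTrans := zeroStrong F G
  isMonoidal := isMonoidal_of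
    (fun a b => by
      simp only [zeroStrong, ← nullL_eq_nullR, Iso.trans_hom, Iso.symm_hom,
        reassoc_of% nullL_whisker, Iso.hom_inv_id_assoc]
      simp only [nullL_eq_nullR, nullR_whisker])
    (fun {a b} f g => by
      dsimp only [zeroStrong, Iso.trans_hom, Iso.symm_hom]
      rw [← cancel_epi ((nullL (F.map f) (G.obj b)).hom ⊞ₘ (nullL (F.map g) (G.obj b)).hom)]
      simp only [← reassoc_of% sum_nullL, reassoc_of% nullL_whisker, Iso.hom_inv_id_assoc,
        MonoidalCategory.tensorHom_comp_tensorHom_assoc, ← reassoc_of% sum_nullR, nullR_whisker])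

/-- The sum of two monoidal transformations is monoidal. -/
def sum (η θ : MonoidalTrans F G) : MonoidalTrans F G where
  toStrongTrans := sumStrong η θ
  isMonoidal := isMonoidal_of
    (fun a b => by
      dsimp only [sumStrong, Iso.trans_hom, Iso.symm_hom]
      rw [← cancel_epi (MonoidalCategoryStruct.leftUnitor _).hom]
      simp only [MonoidalCategory.tensorIso_hom, reassoc_of% sum_nullR, reassoc_of% sum_nullL,
        distribR_whisker, reassoc_of% distribL_whisker, Iso.hom_inv_id_assoc,
        MonoidalCategory.tensorHom_comp_tensorHom_assoc, naturality_zero])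
    (fun {a b} f g => by
      dsimp only [sumStrong, Iso.trans_hom, Iso.symm_hom]
      rw [← cancel_epi ((distribL (F.map f) (η.app b) (θ.app b)).hom ⊞ₘ
        (distribL (F.map g) (η.app b) (θ.app b)).hom)]
      simp only [reassoc_of% interchange, MonoidalCategory.tensorHom_comp_tensorHom_assoc,
        Iso.hom_inv_id_assoc, reassoc_of% distribL_whisker, MonoidalCategory.tensorIso_hom,
        naturality_sum]
      simp only [← MonoidalCategory.tensorHom_comp_tensorHom, Category.assoc,
        reassoc_of% interchange_symm, ← distribR_whisker,
        ← reassoc_of% MonoidalCategory.tensorμ_natural])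

end
end MonoidalTrans

section
open Functor.LaxMonoidal Functor.OplaxMonoidal Functor.Monoidal
variable {X : Type u₁} [Category.{v₁} X] [MonoidalCategory X]
  {Y : Type u₂} [Category.{v₂} Y] [MonoidalCategory Y]
  {Z : Type u₃} [Category.{v₃} Z] [MonoidalCategory Z]
  {P : X ⥤ Z} {Q : Y ⥤ Z}

lemma box_associator [P.Monoidal] [Q.Monoidal]
    {x x' x'' : X} {y y' y'' : Y} (s : P.obj x ⟶ Q.obj y) (s' : P.obj x' ⟶ Q.obj y')
    (s'' : P.obj x'' ⟶ Q.obj y'') :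
    P.map (MonoidalCategoryStruct.associator x x' x'').hom ≫ δ P x (x' ⊞ x'') ≫
        (s ⊞ₘ (δ P x' x'' ≫ (s' ⊞ₘ s'') ≫ μ Q y' y'')) ≫ μ Q y (y' ⊞ y'') =
      (δ P (x ⊞ x') x'' ≫ ((δ P x x' ≫ (s ⊞ₘ s') ≫ μ Q y y') ⊞ₘ s'') ≫ μ Q (y ⊞ y') y'') ≫
        Q.map (MonoidalCategoryStruct.associator y y' y'').hom := by
  have h₁ : (s ⊞ₘ (δ P x' x'' ≫ (s' ⊞ₘ s'') ≫ μ Q y' y'')) =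
      MonoidalCategoryStruct.whiskerLeft _ (δ P x' x'') ≫ (s ⊞ₘ (s' ⊞ₘ s'')) ≫
        MonoidalCategoryStruct.whiskerLeft _ (μ Q y' y'') := by
    simp [← MonoidalCategory.id_tensorHom, MonoidalCategory.tensorHom_comp_tensorHom]
  have h₂ : ((δ P x x' ≫ (s ⊞ₘ s') ≫ μ Q y y') ⊞ₘ s'') =
      MonoidalCategoryStruct.whiskerRight (δ P x x') _ ≫ ((s ⊞ₘ s') ⊞ₘ s'') ≫
        MonoidalCategoryStruct.whiskerRight (μ Q y y') _ := by
    simp only [← MonoidalCategory.tensorHom_id, MonoidalCategory.tensorHom_comp_tensorHom,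
      Category.id_comp, Category.comp_id]
  rw [h₁, h₂]
  simp only [Category.assoc, Functor.LaxMonoidal.associativity]
  rw [map_associator]
  simp only [Category.assoc, μ_δ_assoc, whiskerLeft_μ_δ_assoc,
    MonoidalCategory.associator_naturality_assoc]

lemma box_leftUnitor [P.Monoidal] [Q.Monoidal] {x : X} {y : Y} (s : P.obj x ⟶ Q.obj y) :
    P.map (MonoidalCategoryStruct.leftUnitor x).hom ≫ s =
      (δ P 𝟬 x ≫ ((η P ≫ Functor.LaxMonoidal.ε Q) ⊞ₘ s) ≫ μ Q 𝟬 y) ≫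
        Q.map (MonoidalCategoryStruct.leftUnitor y).hom := by
  have h : ((η P ≫ Functor.LaxMonoidal.ε Q) ⊞ₘ s) =
      MonoidalCategoryStruct.whiskerRight (η P) _ ≫ MonoidalCategoryStruct.whiskerLeft _ s ≫
        MonoidalCategoryStruct.whiskerRight (Functor.LaxMonoidal.ε Q) _ := by
    simp [← MonoidalCategory.id_tensorHom, ← MonoidalCategory.tensorHom_id,
      MonoidalCategory.tensorHom_comp_tensorHom]
  rw [h]
  simp only [Category.assoc, ← Functor.LaxMonoidal.left_unitality]
  rw [map_leftUnitor]
  simp only [Category.assoc, MonoidalCategory.leftUnitor_naturality]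

lemma box_rightUnitor [P.Monoidal] [Q.Monoidal] {x : X} {y : Y} (s : P.obj x ⟶ Q.obj y) :
    P.map (MonoidalCategoryStruct.rightUnitor x).hom ≫ s =
      (δ P x 𝟬 ≫ (s ⊞ₘ (η P ≫ Functor.LaxMonoidal.ε Q)) ≫ μ Q y 𝟬) ≫
        Q.map (MonoidalCategoryStruct.rightUnitor y).hom := by
  have h : (s ⊞ₘ (η P ≫ Functor.LaxMonoidal.ε Q)) =
      MonoidalCategoryStruct.whiskerLeft _ (η P) ≫ MonoidalCategoryStruct.whiskerRight s _ ≫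
        MonoidalCategoryStruct.whiskerLeft _ (Functor.LaxMonoidal.ε Q) := by
    simp [← MonoidalCategory.id_tensorHom, ← MonoidalCategory.tensorHom_id,
      MonoidalCategory.tensorHom_comp_tensorHom]
  rw [h]
  simp only [Category.assoc, ← Functor.LaxMonoidal.right_unitality]
  rw [map_rightUnitor]
  simp only [Category.assoc, MonoidalCategory.rightUnitor_naturality]

lemma box_braiding [BraidedCategory X] [BraidedCategory Y] [BraidedCategory Z]
    [P.Braided] [Q.Braided] {x x' : X} {y y' : Y} (s : P.obj x ⟶ Q.obj y)
    (s' : P.obj x' ⟶ Q.obj y') :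
    P.map (BraidedCategory.braiding x x').hom ≫ δ P x' x ≫ (s' ⊞ₘ s) ≫ μ Q y' y =
      (δ P x x' ≫ (s ⊞ₘ s') ≫ μ Q y y') ≫ Q.map (BraidedCategory.braiding y y').hom := by
  simp

end

namespace SMCFunctor
section
open scoped Pseudofunctor.StrongTrans
variable {B : Type u₁} [Bicategory.{w₁, v₁} B] [SMCCategory B]
  {C : Type u₂} [Bicategory.{w₂, v₂} C] [SMCCategory C]

/-- Monoidal transformations from `F` to `G`, and modifications between them. -/
instance homCategory (F G : SMCFunctor B C) : Category (MonoidalTrans F G) where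
  Hom η θ := Pseudofunctor.StrongTrans.Modification η.hom θ.hom
  id η := Pseudofunctor.StrongTrans.Modification.id η.hom
  comp Γ Γ' := Pseudofunctor.StrongTrans.Modification.vcomp Γ Γ'
  id_comp _ := Pseudofunctor.StrongTrans.Modification.ext (funext fun _ => Category.id_comp _)
  comp_id _ := Pseudofunctor.StrongTrans.Modification.ext (funext fun _ => Category.comp_id _)
  assoc _ _ _ := Pseudofunctor.StrongTrans.Modification.ext (funext fun _ => Category.assoc _ _ _)

/-- The component at `a` of a modification. -/
abbrev _root_.MonoidalTrans.modApp {F G : SMCFunctor B C} {η θ : MonoidalTrans F G} (Γ : η ⟶ θ)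
    (a : B) : η.app a ⟶ θ.app a :=
  Pseudofunctor.StrongTrans.Modification.app Γ a

lemma _root_.MonoidalTrans.mod_ext {F G : SMCFunctor B C} {η θ : MonoidalTrans F G} {Γ Γ' : η ⟶ θ}
    (h : ∀ a, MonoidalTrans.modApp Γ a = MonoidalTrans.modApp Γ' a) : Γ = Γ' :=
  Pseudofunctor.StrongTrans.Modification.ext (funext h)

/-- An invertible modification, from its components. -/
def _root_.MonoidalTrans.modIso {F G : SMCFunctor B C} {η θ : MonoidalTrans F G}
    (app : ∀ a, η.app a ≅ θ.app a)
    (naturality : ∀ {a b} (f : a ⟶ b),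
      F.map f ◁ (app b).hom ≫ (θ.naturality f).hom =
        (η.naturality f).hom ≫ (app a).hom ▷ G.map f) : η ≅ θ where
  hom := { app := fun a => (app a).hom, naturality := naturality }
  inv := { app := fun a => (app a).inv
           naturality := fun {a b} f => by
            rw [← cancel_epi (F.map f ◁ (app b).hom), reassoc_of% naturality f]
            simp }
  hom_inv_id := MonoidalTrans.mod_ext fun a => (app a).hom_inv_id
  inv_hom_id := MonoidalTrans.mod_ext fun a => (app a).inv_hom_id

open MonoidalTrans

/-- Left whiskering of a modification. -/
def whiskerLeft {F G H : SMCFunctor B C} (η : MonoidalTrans F G) {θ θ' : MonoidalTrans G H}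
    (Γ : θ ⟶ θ') : η.comp θ ⟶ η.comp θ' :=
  (Pseudofunctor.StrongTrans.whiskerLeft η.hom (Pseudofunctor.StrongTrans.Hom.of Γ)).as

/-- Right whiskering of a modification. -/
def whiskerRight {F G H : SMCFunctor B C} {η η' : MonoidalTrans F G} (Γ : η ⟶ η')
    (θ : MonoidalTrans G H) : η.comp θ ⟶ η'.comp θ :=
  (Pseudofunctor.StrongTrans.whiskerRight (Pseudofunctor.StrongTrans.Hom.of Γ) θ.hom).as

/-- The associator for composition of transformations. -/
def associator {F G H I : SMCFunctor B C} (η : MonoidalTrans F G) (θ : MonoidalTrans G H)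
    (ι : MonoidalTrans H I) : (η.comp θ).comp ι ≅ η.comp (θ.comp ι) :=
  modIso (fun a => α_ (η.app a) (θ.app a) (ι.app a))
    (Pseudofunctor.StrongTrans.associator η.hom θ.hom ι.hom).hom.as.naturality

/-- The left unitor for composition of transformations. -/
def leftUnitor {F G : SMCFunctor B C} (η : MonoidalTrans F G) : (MonoidalTrans.id F).comp η ≅ η :=
  modIso (fun a => λ_ (η.app a))
    (Pseudofunctor.StrongTrans.leftUnitor η.hom).hom.as.naturality

/-- The right unitor for composition of transformations. -/
def rightUnitor {F G : SMCFunctor B C} (η : MonoidalTrans F G) : η.comp (MonoidalTrans.id G) ≅ η :=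
  modIso (fun a => ρ_ (η.app a))
    (Pseudofunctor.StrongTrans.rightUnitor η.hom).hom.as.naturality

/-- The bicategory of SMC-functors from `B` to `C`, strong monoidal transformations, and
modifications. -/
instance bicategory : Bicategory (SMCFunctor B C) where
  Hom F G := MonoidalTrans F G
  id F := MonoidalTrans.id F
  comp η θ := MonoidalTrans.comp η θ
  homCategory F G := homCategory F G
  whiskerLeft η _ _ Γ := SMCFunctor.whiskerLeft η Γ
  whiskerRight Γ η := SMCFunctor.whiskerRight Γ η
  associator η θ ι := SMCFunctor.associator η θ ι
  leftUnitor η := SMCFunctor.leftUnitor η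
  rightUnitor η := SMCFunctor.rightUnitor η
  whiskerLeft_id _ _ := mod_ext fun _ => Bicategory.whiskerLeft_id _ _
  whiskerLeft_comp _ _ _ _ _ _ := mod_ext fun _ => Bicategory.whiskerLeft_comp _ _ _
  id_whiskerLeft _ := mod_ext fun _ => Bicategory.id_whiskerLeft _
  comp_whiskerLeft _ _ _ _ _ := mod_ext fun _ => Bicategory.comp_whiskerLeft _ _ _
  id_whiskerRight _ _ := mod_ext fun _ => Bicategory.id_whiskerRight _ _
  comp_whiskerRight _ _ _ := mod_ext fun _ => Bicategory.comp_whiskerRight _ _ _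
  whiskerRight_id _ := mod_ext fun _ => Bicategory.whiskerRight_id _
  whiskerRight_comp _ _ _ := mod_ext fun _ => Bicategory.whiskerRight_comp _ _ _
  whisker_assoc _ _ _ _ _ := mod_ext fun _ => Bicategory.whisker_assoc _ _ _
  whisker_exchange _ _ := mod_ext fun _ => Bicategory.whisker_exchange _ _
  pentagon _ _ _ _ := mod_ext fun _ => Bicategory.pentagon _ _ _ _
  triangle _ _ := mod_ext fun _ => Bicategory.triangle _ _

/-- The sum of modifications. -/
def sumMod {F G : SMCFunctor B C} {η θ η' θ' : MonoidalTrans F G} (Γ : η ⟶ θ) (Γ' : η' ⟶ θ') :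
    η.sum η' ⟶ θ.sum θ' where
  app a := modApp Γ a ⊞ₘ modApp Γ' a
  naturality {a b} f := by
    change F.map f ◁ (modApp Γ b ⊞ₘ modApp Γ' b) ≫ (distribL (F.map f) (θ.app b) (θ'.app b)).inv ≫
        ((θ.naturality f).hom ⊞ₘ (θ'.naturality f).hom) ≫
          (distribR (θ.app a) (θ'.app a) (G.map f)).hom =
      ((distribL (F.map f) (η.app b) (η'.app b)).inv ≫
        ((η.naturality f).hom ⊞ₘ (η'.naturality f).hom) ≫
          (distribR (η.app a) (η'.app a) (G.map f)).hom) ≫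
        (modApp Γ a ⊞ₘ modApp Γ' a) ▷ G.map f
    have h₁ := Pseudofunctor.StrongTrans.Modification.naturality Γ f
    have h₂ := Pseudofunctor.StrongTrans.Modification.naturality Γ' f
    rw [← cancel_epi (distribL (F.map f) (η.app b) (η'.app b)).hom]
    simp only [Category.assoc, reassoc_of% distribL_naturality, Iso.hom_inv_id_assoc,
      distribR_naturality, MonoidalCategory.tensorHom_comp_tensorHom_assoc]
    rw [h₁, h₂]

/-- The associator for sum. -/
def sumAssociator {F G : SMCFunctor B C} (η θ ι : MonoidalTrans F G) :
    (η.sum θ).sum ι ≅ η.sum (θ.sum ι) :=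
  modIso (fun a => MonoidalCategoryStruct.associator (η.app a) (θ.app a) (ι.app a))
    (fun {a b} f => box_associator (P := precomp (G.obj b) (F.map f))
      (Q := postcomp (F.obj a) (G.map f)) (η.naturality f).hom (θ.naturality f).hom
      (ι.naturality f).hom)

/-- The left unitor for sum. -/
def sumLeftUnitor {F G : SMCFunctor B C} (η : MonoidalTrans F G) :
    (MonoidalTrans.zero F G).sum η ≅ η :=
  modIso (fun a => MonoidalCategoryStruct.leftUnitor (η.app a))
    (fun {a b} f => box_leftUnitor (P := precomp (G.obj b) (F.map f))
      (Q := postcomp (F.obj a) (G.map f)) (η.naturality f).hom)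

/-- The right unitor for sum. -/
def sumRightUnitor {F G : SMCFunctor B C} (η : MonoidalTrans F G) :
    η.sum (MonoidalTrans.zero F G) ≅ η :=
  modIso (fun a => MonoidalCategoryStruct.rightUnitor (η.app a))
    (fun {a b} f => box_rightUnitor (P := precomp (G.obj b) (F.map f))
      (Q := postcomp (F.obj a) (G.map f)) (η.naturality f).hom)

/-- The braiding for sum. -/
def sumBraiding {F G : SMCFunctor B C} (η θ : MonoidalTrans F G) : η.sum θ ≅ θ.sum η :=
  modIso (fun a => BraidedCategory.braiding (η.app a) (θ.app a))
    (fun {a b} f => box_braiding (P := precomp (G.obj b) (F.map f))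
      (Q := postcomp (F.obj a) (G.map f)) (η.naturality f).hom (θ.naturality f).hom)

end
end SMCFunctor

namespace SMCFunctor
section
variable {B : Type u₁} [Bicategory.{w₁, v₁} B] [SMCCategory B]
  {C : Type u₂} [Bicategory.{w₂, v₂} C] [SMCCategory C]
open MonoidalTrans

/-- Transformations and modifications are added componentwise. -/
@[reducible]
def homMonoidal (F G : SMCFunctor B C) : MonoidalCategory (F ⟶ G) where
  tensorObj η θ := MonoidalTrans.sum η θ
  tensorHom Γ Γ' := sumMod Γ Γ'
  whiskerLeft η _ _ Γ := sumMod (𝟙 η) Γ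
  whiskerRight Γ η := sumMod Γ (𝟙 η)
  tensorUnit := MonoidalTrans.zero F G
  associator η θ ι := sumAssociator η θ ι
  leftUnitor η := sumLeftUnitor η
  rightUnitor η := sumRightUnitor η
  tensorHom_def _ _ := mod_ext fun _ => (by
    change _ ⊞ₘ _ = (_ ⊞ₘ 𝟙 _) ≫ (𝟙 _ ⊞ₘ _)
    simp [MonoidalCategory.tensorHom_def])
  id_tensorHom_id _ _ := mod_ext fun _ => MonoidalCategory.id_tensorHom_id _ _
  tensorHom_comp_tensorHom _ _ _ _ :=
    mod_ext fun _ => MonoidalCategory.tensorHom_comp_tensorHom _ _ _ _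
  whiskerLeft_id _ _ := mod_ext fun _ => MonoidalCategory.id_tensorHom_id _ _
  id_whiskerRight _ _ := mod_ext fun _ => MonoidalCategory.id_tensorHom_id _ _
  associator_naturality _ _ _ := mod_ext fun _ => MonoidalCategory.associator_naturality _ _ _
  leftUnitor_naturality {η θ} Γ := mod_ext fun a => (by
    change (𝟙 _ ⊞ₘ modApp Γ a) ≫ (MonoidalCategoryStruct.leftUnitor (θ.app a)).hom =
      (MonoidalCategoryStruct.leftUnitor (η.app a)).hom ≫ modApp Γ a
    simp)
  rightUnitor_naturality {η θ} Γ := mod_ext fun a => (by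
    change (modApp Γ a ⊞ₘ 𝟙 _) ≫ (MonoidalCategoryStruct.rightUnitor (θ.app a)).hom =
      (MonoidalCategoryStruct.rightUnitor (η.app a)).hom ≫ modApp Γ a
    simp)
  pentagon η θ ι κ := mod_ext fun a => (by
    have := MonoidalCategory.pentagon (η.app a) (θ.app a) (ι.app a) (κ.app a)
    rw [← MonoidalCategory.tensorHom_id, ← MonoidalCategory.id_tensorHom] at this
    exact this)
  triangle η θ := mod_ext fun a => (by
    have := MonoidalCategory.triangle (η.app a) (θ.app a)
    rw [← MonoidalCategory.tensorHom_id, ← MonoidalCategory.id_tensorHom] at this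
    exact this)

attribute [local instance] homMonoidal

/-- The symmetry of the sum, componentwise. -/
@[reducible]
def homSymmetric (F G : SMCFunctor B C) : SymmetricCategory (F ⟶ G) where
  braiding η θ := sumBraiding η θ
  braiding_naturality_right η θ ι Γ := mod_ext fun a => (by
    change (𝟙 _ ⊞ₘ modApp Γ a) ≫ (BraidedCategory.braiding (η.app a) (ι.app a)).hom =
      (BraidedCategory.braiding (η.app a) (θ.app a)).hom ≫ (modApp Γ a ⊞ₘ 𝟙 _)
    simp)
  braiding_naturality_left {η θ} Γ ι := mod_ext fun a => (by
    change (modApp Γ a ⊞ₘ 𝟙 _) ≫ (BraidedCategory.braiding (θ.app a) (ι.app a)).hom =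
      (BraidedCategory.braiding (η.app a) (ι.app a)).hom ≫ (𝟙 _ ⊞ₘ modApp Γ a)
    simp)
  hexagon_forward η θ ι := mod_ext fun a => (by
    have := BraidedCategory.hexagon_forward (η.app a) (θ.app a) (ι.app a)
    rw [← MonoidalCategory.tensorHom_id, ← MonoidalCategory.id_tensorHom] at this
    exact this)
  hexagon_reverse η θ ι := mod_ext fun a => (by
    have := BraidedCategory.hexagon_reverse (η.app a) (θ.app a) (ι.app a)
    rw [← MonoidalCategory.tensorHom_id, ← MonoidalCategory.id_tensorHom] at this
    exact this)
  symmetry η θ := mod_ext fun a => SymmetricCategory.symmetry (η.app a) (θ.app a)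

attribute [local instance] homSymmetric

variable {F G H : SMCFunctor B C}

/-- Left distributivity for transformations, componentwise. -/
def homDistribL (η : F ⟶ G) (θ θ' : G ⟶ H) : (η ≫ θ) ⊞ (η ≫ θ') ≅ η ≫ (θ ⊞ θ') :=
  modIso (η := MonoidalTrans.sum (MonoidalTrans.comp η θ) (MonoidalTrans.comp η θ'))
    (θ := MonoidalTrans.comp η (MonoidalTrans.sum θ θ'))
    (fun a => distribL (η.app a) (θ.app a) (θ'.app a)) (by
    intro a b f
    change F.map f ◁ (distribL (η.app b) (θ.app b) (θ'.app b)).hom ≫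
        (α_ _ _ _).inv ≫ (η.naturality f).hom ▷ (θ.app b ⊞ θ'.app b) ≫ (α_ _ _ _).hom ≫
          η.app a ◁ ((distribL _ _ _).inv ≫ ((θ.naturality f).hom ⊞ₘ (θ'.naturality f).hom) ≫
            (distribR _ _ _).hom) ≫ (α_ _ _ _).inv =
      ((distribL _ _ _).inv ≫
        (((α_ _ _ _).inv ≫ (η.naturality f).hom ▷ θ.app b ≫ (α_ _ _ _).hom ≫
            η.app a ◁ (θ.naturality f).hom ≫ (α_ _ _ _).inv) ⊞ₘ
          ((α_ _ _ _).inv ≫ (η.naturality f).hom ▷ θ'.app b ≫ (α_ _ _ _).hom ≫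
            η.app a ◁ (θ'.naturality f).hom ≫ (α_ _ _ _).inv)) ≫ (distribR _ _ _).hom) ≫
        (distribL (η.app a) (θ.app a) (θ'.app a)).hom ▷ H.map f
    rw [← cancel_epi (distribL _ _ _).hom]
    simp only [Category.assoc, Iso.hom_inv_id_assoc, reassoc_of% distribL_comp_inv,
      reassoc_of% distribL_whisker, distribL_comp (η.app a), Iso.inv_hom_id_assoc,
      whiskerLeft_comp, whiskerLeft_hom_inv_assoc, reassoc_of% distribL_naturality,
      distrib_comp_inv, MonoidalCategory.tensorHom_comp_tensorHom_assoc])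

/-- Right distributivity for transformations, componentwise. -/
def homDistribR (η η' : F ⟶ G) (θ : G ⟶ H) : (η ≫ θ) ⊞ (η' ≫ θ) ≅ (η ⊞ η') ≫ θ :=
  modIso (η := MonoidalTrans.sum (MonoidalTrans.comp η θ) (MonoidalTrans.comp η' θ))
    (θ := MonoidalTrans.comp (MonoidalTrans.sum η η') θ)
    (fun a => distribR (η.app a) (η'.app a) (θ.app a)) (by
    intro a b f
    change F.map f ◁ (distribR (η.app b) (η'.app b) (θ.app b)).hom ≫
        (α_ _ _ _).inv ≫ ((distribL _ _ _).inv ≫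
          ((η.naturality f).hom ⊞ₘ (η'.naturality f).hom) ≫ (distribR _ _ _).hom) ▷ θ.app b ≫
          (α_ _ _ _).hom ≫ (η.app a ⊞ η'.app a) ◁ (θ.naturality f).hom ≫ (α_ _ _ _).inv =
      ((distribL _ _ _).inv ≫
        (((α_ _ _ _).inv ≫ (η.naturality f).hom ▷ θ.app b ≫ (α_ _ _ _).hom ≫
            η.app a ◁ (θ.naturality f).hom ≫ (α_ _ _ _).inv) ⊞ₘ
          ((α_ _ _ _).inv ≫ (η'.naturality f).hom ▷ θ.app b ≫ (α_ _ _ _).hom ≫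
            η'.app a ◁ (θ.naturality f).hom ≫ (α_ _ _ _).inv)) ≫ (distribR _ _ _).hom) ≫
        (distribR (η.app a) (η'.app a) (θ.app a)).hom ▷ H.map f
    rw [← cancel_epi (distribL _ _ _).hom]
    simp only [Category.assoc, Iso.hom_inv_id_assoc, reassoc_of% distrib_comp_inv,
      comp_whiskerRight, hom_inv_whiskerRight_assoc, reassoc_of% distribR_naturality,
      reassoc_of% distribR_associator, reassoc_of% distribR_whisker,
      distribR_comp _ _ (θ.app a), Iso.hom_inv_id, Category.comp_id,
      MonoidalCategory.tensorHom_comp_tensorHom_assoc])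

/-- The zero transformation is right absorbing. -/
def homNullL (η : F ⟶ G) (H : SMCFunctor B C) : (𝟬 : F ⟶ H) ≅ η ≫ (𝟬 : G ⟶ H) :=
  modIso (η := MonoidalTrans.zero F H) (θ := MonoidalTrans.comp η (MonoidalTrans.zero G H))
    (fun a => nullL (η.app a) (H.obj a)) (by
    intro a b f
    change F.map f ◁ (nullL (η.app b) (H.obj b)).hom ≫
        (α_ _ _ _).inv ≫ (η.naturality f).hom ▷ 𝟬 ≫ (α_ _ _ _).hom ≫
          η.app a ◁ ((nullL _ _).inv ≫ (nullR _ _).hom) ≫ (α_ _ _ _).inv =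
      ((nullL _ _).inv ≫ (nullR _ _).hom) ≫ (nullL (η.app a) (H.obj a)).hom ▷ H.map f
    rw [← cancel_epi (nullL _ _).hom]
    simp only [Category.assoc, Iso.hom_inv_id_assoc, ← reassoc_of% nullL_comp,
      reassoc_of% nullL_whisker, null_comp]
    simp only [nullL_comp, Category.assoc, Iso.inv_hom_id_assoc, whiskerLeft_comp,
      whiskerLeft_hom_inv_assoc])

/-- The zero transformation is left absorbing. -/
def homNullR (F : SMCFunctor B C) (θ : G ⟶ H) : (𝟬 : F ⟶ H) ≅ (𝟬 : F ⟶ G) ≫ θ :=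
  modIso (η := MonoidalTrans.zero F H) (θ := MonoidalTrans.comp (MonoidalTrans.zero F G) θ)
    (fun a => nullR (F.obj a) (θ.app a)) (by
    intro a b f
    change F.map f ◁ (nullR (F.obj b) (θ.app b)).hom ≫
        (α_ _ _ _).inv ≫ ((nullL _ _).inv ≫ (nullR _ _).hom) ▷ θ.app b ≫ (α_ _ _ _).hom ≫
          𝟬 ◁ (θ.naturality f).hom ≫ (α_ _ _ _).inv =
      ((nullL _ _).inv ≫ (nullR _ _).hom) ≫ (nullR (F.obj a) (θ.app a)).hom ▷ H.map f
    rw [← cancel_epi (nullL _ _).hom]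
    simp only [Category.assoc, Iso.hom_inv_id_assoc, ← reassoc_of% null_comp, comp_whiskerRight,
      hom_inv_whiskerRight_assoc, reassoc_of% nullR_associator, reassoc_of% nullR_whisker]
    simp only [nullR_comp, Category.assoc, Iso.hom_inv_id, Category.comp_id])

/-- Composition with a fixed first transformation is symmetric strong monoidal. -/
@[reducible]
def homPrecompBraided (η : F ⟶ G) (H : SMCFunctor B C) : (precomp H η).Braided where
  toMonoidal := Functor.CoreMonoidal.toMonoidal
    { εIso := homNullL η H
      μIso := fun θ θ' => homDistribL η θ θ'
      μIso_hom_natural_left := fun Γ θ => mod_ext fun a => (by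
        have := Functor.LaxMonoidal.μ_natural_left (precomp (H.obj a) (η.app a)) (modApp Γ a) (θ.app a)
        simp only [← MonoidalCategory.tensorHom_id] at this
        exact this)
      μIso_hom_natural_right := fun θ Γ => mod_ext fun a => (by
        have := Functor.LaxMonoidal.μ_natural_right (precomp (H.obj a) (η.app a)) (θ.app a) (modApp Γ a)
        simp only [← MonoidalCategory.id_tensorHom] at this
        exact this)
      associativity := fun θ θ' θ'' => mod_ext fun a => (by
        have := Functor.LaxMonoidal.associativity (precomp (H.obj a) (η.app a))
          (θ.app a) (θ'.app a) (θ''.app a)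
        rw [← MonoidalCategory.tensorHom_id, ← MonoidalCategory.id_tensorHom] at this
        exact this)
      left_unitality := fun θ => mod_ext fun a => (by
        have := Functor.LaxMonoidal.left_unitality (precomp (H.obj a) (η.app a)) (θ.app a)
        rw [← MonoidalCategory.tensorHom_id] at this
        exact this)
      right_unitality := fun θ => mod_ext fun a => (by
        have := Functor.LaxMonoidal.right_unitality (precomp (H.obj a) (η.app a)) (θ.app a)
        rw [← MonoidalCategory.id_tensorHom] at this
        exact this) }
  braided θ θ' := mod_ext fun a => Functor.LaxBraided.braided (F := precomp (H.obj a) (η.app a)) (θ.app a) (θ'.app a)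

/-- Composition with a fixed second transformation is symmetric strong monoidal. -/
@[reducible]
def homPostcompBraided (θ : G ⟶ H) (F : SMCFunctor B C) : (postcomp F θ).Braided where
  toMonoidal := Functor.CoreMonoidal.toMonoidal
    { εIso := homNullR F θ
      μIso := fun η η' => homDistribR η η' θ
      μIso_hom_natural_left := fun Γ η => mod_ext fun a => (by
        have := Functor.LaxMonoidal.μ_natural_left (postcomp (F.obj a) (θ.app a)) (modApp Γ a) (η.app a)
        simp only [← MonoidalCategory.tensorHom_id] at this
        exact this)
      μIso_hom_natural_right := fun η Γ => mod_ext fun a => (by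
        have := Functor.LaxMonoidal.μ_natural_right (postcomp (F.obj a) (θ.app a)) (η.app a) (modApp Γ a)
        simp only [← MonoidalCategory.id_tensorHom] at this
        exact this)
      associativity := fun η η' η'' => mod_ext fun a => (by
        have := Functor.LaxMonoidal.associativity (postcomp (F.obj a) (θ.app a))
          (η.app a) (η'.app a) (η''.app a)
        rw [← MonoidalCategory.tensorHom_id, ← MonoidalCategory.id_tensorHom] at this
        exact this)
      left_unitality := fun η => mod_ext fun a => (by
        have := Functor.LaxMonoidal.left_unitality (postcomp (F.obj a) (θ.app a)) (η.app a)
        rw [← MonoidalCategory.tensorHom_id] at this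
        exact this)
      right_unitality := fun η => mod_ext fun a => (by
        have := Functor.LaxMonoidal.right_unitality (postcomp (F.obj a) (θ.app a)) (η.app a)
        rw [← MonoidalCategory.id_tensorHom] at this
        exact this) }
  braided η η' := mod_ext fun a => Functor.LaxBraided.braided (F := postcomp (F.obj a) (θ.app a)) (η.app a) (η'.app a)

variable (B C) in
/-- The bicategory of SMC-functors from `B` to `C` is an SMC-category. -/
instance smcCategory : SMCCategory (SMCFunctor B C) where
  monoidal := homMonoidal
  symmetric := homSymmetric
  precompBraided := homPrecompBraided
  postcompBraided := homPostcompBraided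
  precomp_natural {_ _} H {_ _} Γ := isMonoidal_mk
    (mod_ext fun a => nullL_whisker (modApp Γ a) (H.obj a))
    (fun θ θ' => mod_ext fun a => distribL_whisker (modApp Γ a) (θ.app a) (θ'.app a))
  postcomp_natural F {_ _ _ _} Γ := isMonoidal_mk
    (mod_ext fun a => nullR_whisker (F.obj a) (modApp Γ a))
    (fun η η' => mod_ext fun a => distribR_whisker (η.app a) (η'.app a) (modApp Γ a))
  null_null F G H := mod_ext fun a => null_null (F.obj a) (G.obj a) (H.obj a)
  sum_null {_ _} H η η' := mod_ext fun a => sum_null (H.obj a) (η.app a) (η'.app a)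
  null_sum F {_ _} θ θ' := mod_ext fun a => null_sum (F.obj a) (θ.app a) (θ'.app a)
  sum_sum η η' θ θ' := mod_ext fun a => (by
    have := sum_sum (η.app a) (η'.app a) (θ.app a) (θ'.app a)
    simp only [MonoidalCategory.tensorμ, ← MonoidalCategory.tensorHom_id,
      ← MonoidalCategory.id_tensorHom] at this
    exact this)
  associator_left F {_ _ _} θ ι := isMonoidal_mk
    (mod_ext fun a => (associator_left (F.obj a) (θ.app a) (ι.app a)).unit)
    (fun η η' => mod_ext fun a =>
      (associator_left (F.obj a) (θ.app a) (ι.app a)).tensor (η.app a) (η'.app a))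
  associator_middle η ι := isMonoidal_mk
    (mod_ext fun a => (associator_middle (η.app a) (ι.app a)).unit)
    (fun θ θ' => mod_ext fun a =>
      (associator_middle (η.app a) (ι.app a)).tensor (θ.app a) (θ'.app a))
  associator_right {_ _ _} η θ I := isMonoidal_mk
    (mod_ext fun a => (associator_right (η.app a) (θ.app a) (I.obj a)).unit)
    (fun ι ι' => mod_ext fun a =>
      (associator_right (η.app a) (θ.app a) (I.obj a)).tensor (ι.app a) (ι'.app a))
  leftUnitor F G := isMonoidal_mk
    (mod_ext fun a => (SMCCategory.leftUnitor (F.obj a) (G.obj a)).unit)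
    (fun η η' => mod_ext fun a =>
      (SMCCategory.leftUnitor (F.obj a) (G.obj a)).tensor (η.app a) (η'.app a))
  rightUnitor F G := isMonoidal_mk
    (mod_ext fun a => (SMCCategory.rightUnitor (F.obj a) (G.obj a)).unit)
    (fun η η' => mod_ext fun a =>
      (SMCCategory.rightUnitor (F.obj a) (G.obj a)).tensor (η.app a) (η'.app a))

end
end SMCFunctor

section
variable {B : Type u₁} [Bicategory.{w₁, v₁} B] {C : Type u₂} [Bicategory.{w₂, v₂} C]
  {D : Type u₃} [Bicategory.{w₃, v₃} D]

lemma CategoryTheory.Pseudofunctor.map₂_associator_inv' (F : B ⥤ᵖ C) {a b c d : B} (f : a ⟶ b)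
    (g : b ⟶ c) (h : c ⟶ d) :
    F.map₂ (α_ f g h).inv = (F.mapComp f (g ≫ h)).hom ≫ F.map f ◁ (F.mapComp g h).hom ≫
      (α_ (F.map f) (F.map g) (F.map h)).inv ≫ (F.mapComp f g).inv ▷ F.map h ≫
        (F.mapComp (f ≫ g) h).inv := by
  rw [← cancel_epi (F.map₂ (α_ f g h).hom), ← F.map₂_comp]
  simp

/-- The image of a strong transformation `η` under a pseudofunctor `J`. -/
def CategoryTheory.Pseudofunctor.StrongTrans.postcompose {F G : B ⥤ᵖ C} (η : F.StrongTrans G)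
    (J : C ⥤ᵖ D) : (F.comp J).StrongTrans (G.comp J) where
  app a := J.map (η.app a)
  naturality {a b} f :=
    (J.mapComp (F.map f) (η.app b)).symm ≪≫ J.map₂Iso (η.naturality f) ≪≫
      J.mapComp (η.app a) (G.map f)
  naturality_naturality {a b f g} φ := by
    change J.map₂ (F.map₂ φ) ▷ J.map (η.app b) ≫ (J.mapComp (F.map g) (η.app b)).inv ≫
        J.map₂ (η.naturality g).hom ≫ (J.mapComp (η.app a) (G.map g)).hom =
      ((J.mapComp (F.map f) (η.app b)).inv ≫ J.map₂ (η.naturality f).hom ≫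
        (J.mapComp (η.app a) (G.map f)).hom) ≫ J.map (η.app a) ◁ J.map₂ (G.map₂ φ)
    have h := congrArg J.map₂ (η.naturality_naturality φ)
    simp only [J.map₂_comp, J.map₂_whisker_left, J.map₂_whisker_right, Category.assoc] at h
    rw [← cancel_epi (J.mapComp (F.map f) (η.app b)).hom, reassoc_of% h]
    simp
  naturality_id a := by
    change ((J.mapComp (F.map (𝟙 a)) (η.app a)).inv ≫ J.map₂ (η.naturality (𝟙 a)).hom ≫
        (J.mapComp (η.app a) (G.map (𝟙 a))).hom) ≫
          J.map (η.app a) ◁ (J.map₂ (G.mapId a).hom ≫ (J.mapId (G.obj a)).hom) =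
      (J.map₂ (F.mapId a).hom ≫ (J.mapId (F.obj a)).hom) ▷ J.map (η.app a) ≫
        (λ_ (J.map (η.app a))).hom ≫ (ρ_ (J.map (η.app a))).inv
    have h := congrArg (J.map₂ · ) (η.naturality_id a)
    simp only [J.map₂_comp, J.map₂_whisker_left, J.map₂_whisker_right, Category.assoc] at h
    rw [← cancel_epi (J.mapComp (F.map (𝟙 a)) (η.app a)).hom,
      ← cancel_mono (ρ_ (J.map (η.app a))).hom]
    have h' := congrArg (fun t => t ≫ J.map₂ (ρ_ (η.app a)).hom) h
    simp only [Category.assoc, ← J.map₂_comp, Iso.inv_hom_id] at h'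
    simp only [J.map₂_right_unitor, J.map₂_left_unitor,
      Iso.inv_hom_id_assoc, Category.comp_id] at h'
    simp only [whiskerLeft_comp, comp_whiskerRight, Category.assoc, Iso.hom_inv_id_assoc,
      Iso.inv_hom_id, Category.comp_id]
    exact h'
  naturality_comp {a b c} f g := by
    change ((J.mapComp (F.map (f ≫ g)) (η.app c)).inv ≫ J.map₂ (η.naturality (f ≫ g)).hom ≫
        (J.mapComp (η.app a) (G.map (f ≫ g))).hom) ≫
          J.map (η.app a) ◁ (J.map₂ (G.mapComp f g).hom ≫ (J.mapComp (G.map f) (G.map g)).hom) =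
      (J.map₂ (F.mapComp f g).hom ≫ (J.mapComp (F.map f) (F.map g)).hom) ▷ J.map (η.app c) ≫
        (α_ _ _ _).hom ≫ J.map (F.map f) ◁ ((J.mapComp (F.map g) (η.app c)).inv ≫
          J.map₂ (η.naturality g).hom ≫ (J.mapComp (η.app b) (G.map g)).hom) ≫
        (α_ _ _ _).inv ≫ ((J.mapComp (F.map f) (η.app b)).inv ≫
          J.map₂ (η.naturality f).hom ≫ (J.mapComp (η.app a) (G.map f)).hom) ▷ J.map (G.map g) ≫
        (α_ _ _ _).hom
    have h := congrArg J.map₂ (η.naturality_comp f g)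
    simp only [J.map₂_comp, J.map₂_whisker_left, J.map₂_whisker_right, J.map₂_associator,
      J.map₂_associator_inv', Category.assoc, Iso.inv_hom_id_assoc] at h
    rw [← cancel_epi (J.mapComp (F.map (f ≫ g)) (η.app c)).hom,
      ← cancel_mono (J.map (η.app a) ◁ (J.mapComp (G.map f) (G.map g)).inv),
      ← cancel_mono (J.mapComp (η.app a) (G.map f ≫ G.map g)).inv]
    simp only [whiskerLeft_comp, comp_whiskerRight, Category.assoc, Iso.hom_inv_id_assoc,
      whiskerLeft_hom_inv_assoc] at h ⊢
    rw [h]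

end

namespace MonoidalTrans
section
variable {B : Type u₁} [Bicategory.{w₁, v₁} B] [SMCCategory B]
  {C : Type u₂} [Bicategory.{w₂, v₂} C] [SMCCategory C]
  {D : Type u₃} [Bicategory.{w₃, v₃} D] [SMCCategory D] {F G H : SMCFunctor B C}

open scoped Pseudofunctor.StrongTrans

/-- The image of a monoidal transformation `η` under an SMC-functor `J`. -/
def postcompose (η : MonoidalTrans F G) (J : SMCFunctor C D) :
    MonoidalTrans (F.comp J) (G.comp J) where
  toStrongTrans := η.toStrongTrans.postcompose J.toPseudofunctor
  isMonoidal := isMonoidal_of (F := F.comp J) (G := G.comp J)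
      (η := η.toStrongTrans.postcompose J.toPseudofunctor)
    (fun a b => by
      change (nullR (J.obj (F.obj a)) (J.map (η.app b))).hom ≫
          ((J.mapZero _ _).hom ≫ J.map₂ (F.mapZero a b).hom) ▷ J.map (η.app b) ≫
          (J.mapComp (F.map 𝟬) (η.app b)).inv ≫ J.map₂ (η.naturality 𝟬).hom ≫
            (J.mapComp (η.app a) (G.map 𝟬)).hom =
        (nullL (J.map (η.app a)) (J.obj (G.obj b))).hom ≫
          J.map (η.app a) ◁ ((J.mapZero _ _).hom ≫ J.map₂ (G.mapZero a b).hom)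
      have h := congrArg J.map₂ (η.naturality_zero a b)
      simp only [J.map₂_comp, J.map₂_whisker_left, J.map₂_whisker_right, Category.assoc] at h
      rw [← cancel_mono (J.mapComp (η.app a) (G.map 𝟬)).inv]
      simp only [comp_whiskerRight, whiskerLeft_comp, Category.assoc, ← reassoc_of% J.mapZero_nullR,
        ← reassoc_of% J.mapZero_nullL, Iso.hom_inv_id, Category.comp_id]
      rw [h])
    (fun {a b} f g => by
      change (distribR (J.map (F.map f)) (J.map (F.map g)) (J.map (η.app b))).hom ≫
          ((J.mapSum _ _).hom ≫ J.map₂ (F.mapSum f g).hom) ▷ J.map (η.app b) ≫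
          (J.mapComp (F.map (f ⊞ g)) (η.app b)).inv ≫ J.map₂ (η.naturality (f ⊞ g)).hom ≫
            (J.mapComp (η.app a) (G.map (f ⊞ g))).hom =
        (((J.mapComp (F.map f) (η.app b)).inv ≫ J.map₂ (η.naturality f).hom ≫
            (J.mapComp (η.app a) (G.map f)).hom) ⊞ₘ
          ((J.mapComp (F.map g) (η.app b)).inv ≫ J.map₂ (η.naturality g).hom ≫
            (J.mapComp (η.app a) (G.map g)).hom)) ≫
        (distribL (J.map (η.app a)) (J.map (G.map f)) (J.map (G.map g))).hom ≫
          J.map (η.app a) ◁ ((J.mapSum _ _).hom ≫ J.map₂ (G.mapSum f g).hom)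
      have h := congrArg J.map₂ (η.naturality_sum f g)
      simp only [J.map₂_comp, J.map₂_whisker_left, J.map₂_whisker_right, Category.assoc] at h
      rw [← cancel_mono (J.mapComp (η.app a) (G.map (f ⊞ g))).inv,
        ← cancel_epi ((J.mapComp (F.map f) (η.app b)).hom ⊞ₘ (J.mapComp (F.map g) (η.app b)).hom)]
      simp only [Category.assoc, MonoidalCategory.tensorHom_comp_tensorHom_assoc,
        Iso.hom_inv_id_assoc]
      simp only [← MonoidalCategory.tensorHom_comp_tensorHom]
      simp only [comp_whiskerRight, whiskerLeft_comp, Category.assoc, ← reassoc_of% J.mapSum_distribR,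
        ← reassoc_of% J.mapSum_distribL, Iso.hom_inv_id, Category.comp_id]
      rw [h, reassoc_of% J.mapSum_naturality])

end
end MonoidalTrans

namespace SMCFunctor
section
variable {B : Type u₁} [Bicategory.{w₁, v₁} B] [SMCCategory B]
  {C : Type u₂} [Bicategory.{w₂, v₂} C] [SMCCategory C]
  {D : Type u₃} [Bicategory.{w₃, v₃} D] [SMCCategory D] {F G H : SMCFunctor B C}
open MonoidalTrans

/-- The image of a modification under an SMC-functor `J`. -/
def postcomposeMod {η θ : F ⟶ G} (Γ : η ⟶ θ) (J : SMCFunctor C D) :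
    MonoidalTrans.postcompose η J ⟶ MonoidalTrans.postcompose θ J where
  app a := J.map₂ (modApp Γ a)
  naturality {a b} f := by
    change J.map (F.map f) ◁ J.map₂ (modApp Γ b) ≫ (J.mapComp (F.map f) (θ.app b)).inv ≫
        J.map₂ (θ.naturality f).hom ≫ (J.mapComp (θ.app a) (G.map f)).hom =
      ((J.mapComp (F.map f) (η.app b)).inv ≫ J.map₂ (η.naturality f).hom ≫
        (J.mapComp (η.app a) (G.map f)).hom) ≫ J.map₂ (modApp Γ a) ▷ J.map (G.map f)
    have h := congrArg J.map₂ (Pseudofunctor.StrongTrans.Modification.naturality Γ f)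
    simp only [J.map₂_comp, J.map₂_whisker_left, J.map₂_whisker_right, Category.assoc] at h
    rw [← cancel_epi (J.mapComp (F.map f) (η.app b)).hom,
      ← cancel_mono (J.mapComp (θ.app a) (G.map f)).inv]
    simp only [Category.assoc, Iso.hom_inv_id, Category.comp_id, Iso.hom_inv_id_assoc]
    exact h

/-- `J (𝟙 F) ≅ 𝟙 (F ⋙ J)`, with components those of `J`. -/
def postcomposeId (F : SMCFunctor B C) (J : SMCFunctor C D) :
    MonoidalTrans.postcompose (MonoidalTrans.id F) J ≅ MonoidalTrans.id (F.comp J) :=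
  modIso (fun a => J.mapId (F.obj a)) (by
    intro a b f
    change J.map (F.map f) ◁ (J.mapId (F.obj b)).hom ≫ (ρ_ _).hom ≫ (λ_ _).inv =
      ((J.mapComp (F.map f) (𝟙 (F.obj b))).inv ≫ J.map₂ ((ρ_ (F.map f)).hom ≫ (λ_ (F.map f)).inv) ≫
        (J.mapComp (𝟙 (F.obj a)) (F.map f)).hom) ≫ (J.mapId (F.obj a)).hom ▷ J.map (F.map f)
    rw [← cancel_epi (J.mapComp (F.map f) (𝟙 (F.obj b))).hom, ← cancel_mono (λ_ _).hom]
    simp only [Category.assoc, Iso.inv_hom_id, Category.comp_id, Iso.hom_inv_id_assoc]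
    rw [← J.map₂_right_unitor, ← J.map₂_left_unitor, ← J.map₂_comp]
    simp)

/-- `J (η ≫ θ) ≅ J η ≫ J θ`, with components those of `J`. -/
def postcomposeComp (η : F ⟶ G) (θ : G ⟶ H) (J : SMCFunctor C D) :
    MonoidalTrans.postcompose (MonoidalTrans.comp η θ) J ≅
      (MonoidalTrans.postcompose η J).comp (MonoidalTrans.postcompose θ J) :=
  modIso (fun a => J.mapComp (η.app a) (θ.app a)) (by
    intro a b f
    change J.map (F.map f) ◁ (J.mapComp (η.app b) (θ.app b)).hom ≫
        (α_ _ _ _).inv ≫ ((J.mapComp (F.map f) (η.app b)).inv ≫ J.map₂ (η.naturality f).hom ≫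
          (J.mapComp (η.app a) (G.map f)).hom) ▷ J.map (θ.app b) ≫ (α_ _ _ _).hom ≫
        J.map (η.app a) ◁ ((J.mapComp (G.map f) (θ.app b)).inv ≫ J.map₂ (θ.naturality f).hom ≫
          (J.mapComp (θ.app a) (H.map f)).hom) ≫ (α_ _ _ _).inv =
      ((J.mapComp (F.map f) (η.app b ≫ θ.app b)).inv ≫
        J.map₂ ((α_ _ _ _).inv ≫ (η.naturality f).hom ▷ θ.app b ≫ (α_ _ _ _).hom ≫
          η.app a ◁ (θ.naturality f).hom ≫ (α_ _ _ _).inv) ≫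
        (J.mapComp (η.app a ≫ θ.app a) (H.map f)).hom) ≫
          (J.mapComp (η.app a) (θ.app a)).hom ▷ J.map (H.map f)
    simp only [J.map₂_comp, J.map₂_whisker_left, J.map₂_whisker_right, J.map₂_associator,
      J.map₂_associator_inv', Category.assoc, Iso.inv_hom_id_assoc, whiskerLeft_comp,
      comp_whiskerRight]
    simp)

variable (B) in
/-- Postcomposition with an SMC-functor `J`, as a pseudofunctor. -/
def postcomposePseudofunctor (J : SMCFunctor C D) : SMCFunctor B C ⥤ᵖ SMCFunctor B D where
  obj F := F.comp J
  map η := MonoidalTrans.postcompose η J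
  map₂ Γ := postcomposeMod Γ J
  map₂_id η := mod_ext fun a => J.map₂_id (η.app a)
  map₂_comp Γ Γ' := mod_ext fun a => J.map₂_comp (modApp Γ a) (modApp Γ' a)
  mapId F := postcomposeId F J
  mapComp η θ := postcomposeComp η θ J
  map₂_whisker_left η _ _ Γ := mod_ext fun a => J.map₂_whisker_left (η.app a) (modApp Γ a)
  map₂_whisker_right Γ θ := mod_ext fun a => J.map₂_whisker_right (modApp Γ a) (θ.app a)
  map₂_associator η θ ι := mod_ext fun a => J.map₂_associator (η.app a) (θ.app a) (ι.app a)
  map₂_left_unitor η := mod_ext fun a => J.map₂_left_unitor (η.app a)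
  map₂_right_unitor η := mod_ext fun a => J.map₂_right_unitor (η.app a)

/-- `𝟬 ≅ J 𝟬`, with components those of `J`. -/
def postcomposeZero (F G : SMCFunctor B C) (J : SMCFunctor C D) :
    (𝟬 : F.comp J ⟶ G.comp J) ≅ MonoidalTrans.postcompose (𝟬 : F ⟶ G) J :=
  modIso (η := MonoidalTrans.zero (F.comp J) (G.comp J))
    (θ := MonoidalTrans.postcompose (MonoidalTrans.zero F G) J)
    (fun a => J.mapZero (F.obj a) (G.obj a)) (by
    intro a b f
    change J.map (F.map f) ◁ (J.mapZero (F.obj b) (G.obj b)).hom ≫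
        (J.mapComp (F.map f) 𝟬).inv ≫ J.map₂ ((nullL _ _).inv ≫ (nullR _ _).hom) ≫
          (J.mapComp 𝟬 (G.map f)).hom =
      ((nullL _ _).inv ≫ (nullR _ _).hom) ≫
        (J.mapZero (F.obj a) (G.obj a)).hom ▷ J.map (G.map f)
    rw [← cancel_epi (nullL _ _).hom]
    simp only [Category.assoc, Iso.hom_inv_id_assoc, ← reassoc_of% J.mapZero_nullL,
      ← J.mapZero_nullR]
    rw [← J.map₂_comp_assoc]
    simp)

/-- `J η ⊞ J θ ≅ J (η ⊞ θ)`, with components those of `J`. -/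
def postcomposeSum (η θ : F ⟶ G) (J : SMCFunctor C D) :
    (MonoidalTrans.postcompose η J).sum (MonoidalTrans.postcompose θ J) ≅
      MonoidalTrans.postcompose (MonoidalTrans.sum η θ) J :=
  modIso (fun a => J.mapSum (η.app a) (θ.app a)) (by
    intro a b f
    change J.map (F.map f) ◁ (J.mapSum (η.app b) (θ.app b)).hom ≫
        (J.mapComp (F.map f) (η.app b ⊞ θ.app b)).inv ≫
          J.map₂ ((distribL _ _ _).inv ≫ ((η.naturality f).hom ⊞ₘ (θ.naturality f).hom) ≫
            (distribR _ _ _).hom) ≫ (J.mapComp (η.app a ⊞ θ.app a) (G.map f)).hom =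
      ((distribL _ _ _).inv ≫ (((J.mapComp (F.map f) (η.app b)).inv ≫
          J.map₂ (η.naturality f).hom ≫ (J.mapComp (η.app a) (G.map f)).hom) ⊞ₘ
        ((J.mapComp (F.map f) (θ.app b)).inv ≫
          J.map₂ (θ.naturality f).hom ≫ (J.mapComp (θ.app a) (G.map f)).hom)) ≫
            (distribR _ _ _).hom) ≫
        (J.mapSum (η.app a) (θ.app a)).hom ▷ J.map (G.map f)
    rw [← cancel_epi (distribL _ _ _).hom,
      ← cancel_epi ((J.mapComp (F.map f) (η.app b)).hom ⊞ₘ (J.mapComp (F.map f) (θ.app b)).hom)]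
    simp only [Category.assoc, Iso.hom_inv_id_assoc,
      MonoidalCategory.tensorHom_comp_tensorHom_assoc]
    simp only [← MonoidalCategory.tensorHom_comp_tensorHom, Category.assoc,
      ← reassoc_of% J.mapSum_distribL, ← J.mapSum_distribR, Iso.hom_inv_id_assoc]
    simp only [← J.map₂_comp_assoc, Iso.hom_inv_id_assoc, ← reassoc_of% J.mapSum_naturality])

/-- Postcomposition is symmetric strong monoidal on transformations. -/
@[reducible]
def postcomposeBraided (J : SMCFunctor C D) (F G : SMCFunctor B C) :
    ((postcomposePseudofunctor B J).mapFunctor F G).Braided where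
  toMonoidal := Functor.CoreMonoidal.toMonoidal
    { εIso := postcomposeZero F G J
      μIso := fun η θ => postcomposeSum η θ J
      μIso_hom_natural_left := fun Γ θ => mod_ext fun a => (by
        have := Functor.LaxMonoidal.μ_natural_left (J.mapFunctor (F.obj a) (G.obj a))
          (modApp Γ a) (θ.app a)
        simp only [← MonoidalCategory.tensorHom_id] at this
        exact this)
      μIso_hom_natural_right := fun θ Γ => mod_ext fun a => (by
        have := Functor.LaxMonoidal.μ_natural_right (J.mapFunctor (F.obj a) (G.obj a))
          (θ.app a) (modApp Γ a)
        simp only [← MonoidalCategory.id_tensorHom] at this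
        exact this)
      associativity := fun η θ ι => mod_ext fun a => (by
        have := Functor.LaxMonoidal.associativity (J.mapFunctor (F.obj a) (G.obj a))
          (η.app a) (θ.app a) (ι.app a)
        rw [← MonoidalCategory.tensorHom_id, ← MonoidalCategory.id_tensorHom] at this
        exact this)
      left_unitality := fun η => mod_ext fun a => (by
        have := Functor.LaxMonoidal.left_unitality (J.mapFunctor (F.obj a) (G.obj a)) (η.app a)
        rw [← MonoidalCategory.tensorHom_id] at this
        exact this)
      right_unitality := fun η => mod_ext fun a => (by
        have := Functor.LaxMonoidal.right_unitality (J.mapFunctor (F.obj a) (G.obj a)) (η.app a)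
        rw [← MonoidalCategory.id_tensorHom] at this
        exact this) }
  braided η θ := mod_ext fun a =>
    Functor.LaxBraided.braided (F := J.mapFunctor (F.obj a) (G.obj a)) (η.app a) (θ.app a)

variable (B) in
/-- Postcomposition with an SMC-functor `J : C → D`, as an SMC-functor from the SMC-category of
SMC-functors `B → C` to the SMC-category of SMC-functors `B → D`. -/
def postcompose (J : SMCFunctor C D) : SMCFunctor (SMCFunctor B C) (SMCFunctor B D) where
  toPseudofunctor := postcomposePseudofunctor B J
  braided := postcomposeBraided J
  mapComp_right η H := isMonoidal_mk
    (mod_ext fun a => (J.mapComp_right (η.app a) (H.obj a)).unit)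
    (fun θ θ' => mod_ext fun a =>
      (J.mapComp_right (η.app a) (H.obj a)).tensor (θ.app a) (θ'.app a))
  mapComp_left F {_ _} θ := isMonoidal_mk
    (mod_ext fun a => (J.mapComp_left (F.obj a) (θ.app a)).unit)
    (fun η η' => mod_ext fun a =>
      (J.mapComp_left (F.obj a) (θ.app a)).tensor (η.app a) (η'.app a))

/-- An SMC-functor `F : B → C` is a biequivalence if there are an SMC-functor `G : C → B`, an
internal equivalence between `F ∘ G` and the identity in the bicategory of SMC-functors `C → C`,
and an internal equivalence between the identity and `G ∘ F` in the bicategory of SMC-functors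
`B → B`. -/
def IsBiequivalence (F : SMCFunctor B C) : Prop :=
  ∃ G : SMCFunctor C B, Nonempty (Bicategory.Equivalence (G.comp F) (SMCFunctor.id C)) ∧
    Nonempty (Bicategory.Equivalence (SMCFunctor.id B) (F.comp G))

end
end SMCFunctor

/-! An inverse `G` of `J` yields the inverse `G_*` of `J_*`, because postcomposition carries an
equivalence between `J ∘ G` and the identity to one between `J_* ∘ G_*` and the identity.

Let `η : J ∘ G ⟶ 𝟙` be a monoidal transformation. For each SMC-functor `F : B → D`, whiskering gives
`ηF : J ∘ G ∘ F ⟶ F`, with component `η (F a)` at an object `a` and `2`-cell `η (F f)` at a `1`-cell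
`f`. As `F` varies, the `ηF` are the components of a transformation `J_* ∘ G_* ⟶ 𝟙`, whose `2`-cell
at `θ : F ⟶ F'` is the modification with components `η (θ a)`. The computations are of two kinds.
`counitWhisker` shows that `ηF` is a monoidal transformation: the structure `2`-cells of `F` are
slid across `η` by naturality, after which the laws of `η` apply. `counitWhiskerNaturality` shows
that the `η (θ a)` form a modification: this is naturality of `η` at the `2`-cell of `θ`, with the
values of `η` on the two composite `1`-cells expanded. The laws of the induced transformation itself
cost nothing: they are equations between modifications, hence may be checked at each object of `B`,
where they are laws of `η`.

Transformations `𝟙 ⟶ J ∘ G` are treated in the same way (`unitWhisker`, `unitWhiskerNaturality`). An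
invertible modification between a composite of two such transformations and an identity is likewise
evaluated at the objects `F a`, which gives `postcomposeUnitCounit` and `postcomposeCounitUnit`.
Nothing here uses which of `G` and `J` was given first, so the equivalence between the identity and
`G ∘ J` is handled by the same statements with the two exchanged.

The functors `(J ∘ G) ∘ F` and `J ∘ (G ∘ F)` have the same values, but their unit and composition
constraints agree only after `J` is distributed over a vertical composite of `2`-cells. The
whiskerings therefore go directly to and from `J ∘ (G ∘ F)`, the value of `J_* ∘ G_*` at `F`. -/

namespace MonoidalTrans
section
variable {B : Type u₁} [Bicategory.{w₁, v₁} B] [SMCCategory B]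
  {C : Type u₂} [Bicategory.{w₂, v₂} C] [SMCCategory C]
  {D : Type u₃} [Bicategory.{w₃, v₃} D] [SMCCategory D]
  {G : SMCFunctor D C} {J : SMCFunctor C D}

/-! ### Transformations from `J ∘ G` to the identity, and what they induce on `J_* ∘ G_*`. -/

section Counit

variable (η : MonoidalTrans (G.comp J) (SMCFunctor.id D))

/-- The component of `η : J ∘ G ⟶ 𝟙` at an object. -/
def counitApp (a : D) : J.obj (G.obj a) ⟶ a := η.app a

/-- The `2`-cell of `η : J ∘ G ⟶ 𝟙` at a `1`-cell. -/
def counitCell {a b : D} (f : a ⟶ b) :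
    J.map (G.map f) ≫ η.counitApp b ≅ η.counitApp a ≫ f := η.naturality f

/-- This is how `2`-cells are moved across `η`. It is used below with `φ` a structure `2`-cell of
`F`, or the `2`-cell of a transformation `θ`. In this and the following laws the composite `J ∘ G`
and the identity functor are unfolded. -/
lemma counitCell_naturality {a b : D} {f g : a ⟶ b} (φ : f ⟶ g) :
    J.map₂ (G.map₂ φ) ▷ η.counitApp b ≫ (η.counitCell g).hom =
      (η.counitCell f).hom ≫ η.counitApp a ◁ φ :=
  η.naturality_naturality φ

/-- The target of `η` is the identity functor, whose unit constraint is an identity `2`-cell. Hence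
the unit law of `η` is an outright formula for the cell at `𝟙 a`, without a correction on the target
side. -/
lemma counitCell_id (a : D) :
    (η.counitCell (𝟙 a)).hom =
      (J.map₂ (G.mapId a).hom ≫ (J.mapId (G.obj a)).hom) ▷ η.counitApp a ≫
        (λ_ (η.counitApp a)).hom ≫ (ρ_ (η.counitApp a)).inv := by
  refine Eq.trans ?_ (η.naturality_id a)
  change _ = (η.counitCell (𝟙 a)).hom ≫ η.counitApp a ◁ 𝟙 (𝟙 a)
  simp

/-- Again the constraint of the identity functor drops out, and the cell at a composite is expressed
through the cells at its factors. -/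
lemma counitCell_comp {a b c : D} (f : a ⟶ b) (g : b ⟶ c) :
    (η.counitCell (f ≫ g)).hom =
      (J.map₂ (G.mapComp f g).hom ≫ (J.mapComp (G.map f) (G.map g)).hom) ▷ η.counitApp c ≫
        (α_ _ _ _).hom ≫ J.map (G.map f) ◁ (η.counitCell g).hom ≫
        (α_ _ _ _).inv ≫ (η.counitCell f).hom ▷ g ≫ (α_ _ _ _).hom := by
  refine Eq.trans ?_ (η.naturality_comp f g)
  change _ = (η.counitCell (f ≫ g)).hom ≫ η.counitApp a ◁ 𝟙 (f ≫ g)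
  simp

/-- The identity functor preserves zero and sums strictly, so in this law and the next only the
comparison isomorphisms of `J` and `G` survive. -/
lemma counitCell_zero (a b : D) :
    (nullR (J.obj (G.obj a)) (η.counitApp b)).hom ≫
        ((J.mapZero _ _).hom ≫ J.map₂ (G.mapZero a b).hom) ▷ η.counitApp b ≫
          (η.counitCell 𝟬).hom =
      (nullL (η.counitApp a) b).hom := by
  refine (η.naturality_zero a b).trans ?_
  change (nullL (η.counitApp a) b).hom ≫ η.counitApp a ◁ 𝟙 (𝟬 : a ⟶ b) = _
  simp

lemma counitCell_sum {a b : D} (f g : a ⟶ b) :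
    (distribR (J.map (G.map f)) (J.map (G.map g)) (η.counitApp b)).hom ≫
        ((J.mapSum _ _).hom ≫ J.map₂ (G.mapSum f g).hom) ▷ η.counitApp b ≫
          (η.counitCell (f ⊞ g)).hom =
      ((η.counitCell f).hom ⊞ₘ (η.counitCell g).hom) ≫
        (distribL (η.counitApp a) f g).hom := by
  refine (η.naturality_sum f g).trans ?_
  change ((η.counitCell f).hom ⊞ₘ (η.counitCell g).hom) ≫
    (distribL (η.counitApp a) f g).hom ≫ η.counitApp a ◁ 𝟙 (f ⊞ g) = _
  simp

/-- The whiskering of `η : J ∘ G ⟶ 𝟙` with an SMC-functor `F`. -/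
def counitWhisker (F : SMCFunctor B D) : MonoidalTrans ((F.comp G).comp J) F where
  app a := η.counitApp (F.obj a)
  naturality f := η.counitCell (F.map f)
  naturality_naturality φ := η.counitCell_naturality (F.map₂ φ)
  naturality_id a := by
    change (η.counitCell (F.map (𝟙 a))).hom ≫ η.counitApp (F.obj a) ◁ (F.mapId a).hom =
      (J.map₂ (G.map₂ (F.mapId a).hom ≫ (G.mapId (F.obj a)).hom) ≫
        (J.mapId (G.obj (F.obj a))).hom) ▷ η.counitApp (F.obj a) ≫
          (λ_ (η.counitApp (F.obj a))).hom ≫ (ρ_ (η.counitApp (F.obj a))).inv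
    -- Sliding the unit constraint of `F` across `η` replaces the cell at `F (𝟙 a)` by the cell at
    -- `𝟙 (F a)`, which the unit law computes.
    rw [← η.counitCell_naturality, η.counitCell_id]
    simp only [J.map₂_comp, Bicategory.comp_whiskerRight, Category.assoc]
  naturality_comp {a b c} f g := by
    change (η.counitCell (F.map (f ≫ g))).hom ≫ η.counitApp (F.obj a) ◁ (F.mapComp f g).hom =
      (J.map₂ (G.map₂ (F.mapComp f g).hom ≫ (G.mapComp (F.map f) (F.map g)).hom) ≫
        (J.mapComp (G.map (F.map f)) (G.map (F.map g))).hom) ▷ η.counitApp (F.obj c) ≫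
        (α_ _ _ _).hom ≫ J.map (G.map (F.map f)) ◁ (η.counitCell (F.map g)).hom ≫
        (α_ _ _ _).inv ≫ (η.counitCell (F.map f)).hom ▷ F.map g ≫ (α_ _ _ _).hom
    -- The compositor of `F` is slid across `η` likewise, turning the cell at `F (f ≫ g)` into the
    -- cell at `F f ≫ F g`. What then remains is to distribute `J` over a vertical composite.
    rw [← η.counitCell_naturality, η.counitCell_comp]
    simp only [J.map₂_comp, Bicategory.comp_whiskerRight, Category.assoc]
  isMonoidal a b := SMCFunctor.isMonoidal_mk
    (by
      change ((nullR _ (η.counitApp (F.obj b))).hom ≫ ((J.mapZero _ _).hom ≫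
          J.map₂ ((G.mapZero _ _).hom ≫ G.map₂ (F.mapZero a b).hom)) ▷ η.counitApp (F.obj b)) ≫
            (η.counitCell (F.map 𝟬)).hom =
        (nullL (η.counitApp (F.obj a)) (F.obj b)).hom ≫
          η.counitApp (F.obj a) ◁ (F.mapZero a b).hom
      -- The right side is rewritten through the cell of `η` at the zero `1`-cell of `D`; on the
      -- left, naturality at the comparison `𝟬 ≅ F 𝟬` then produces the same cell.
      rw [← η.counitCell_zero]
      simp only [J.map₂_comp, Bicategory.comp_whiskerRight, Category.assoc,
        η.counitCell_naturality])
    (fun f g => by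
      change ((distribR _ _ (η.counitApp (F.obj b))).hom ≫ ((J.mapSum _ _).hom ≫
          J.map₂ ((G.mapSum _ _).hom ≫ G.map₂ (F.mapSum f g).hom)) ▷ η.counitApp (F.obj b)) ≫
            (η.counitCell (F.map (f ⊞ g))).hom =
        ((η.counitCell (F.map f)).hom ⊞ₘ (η.counitCell (F.map g)).hom) ≫
          (distribL (η.counitApp (F.obj a)) _ _).hom ≫
            η.counitApp (F.obj a) ◁ (F.mapSum f g).hom
      -- The same argument with the comparison `F f ⊞ F g ≅ F (f ⊞ g)`: both sides reduce to the
      -- cell of `η` at `F f ⊞ F g`.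
      rw [← reassoc_of% η.counitCell_sum]
      simp only [J.map₂_comp, Bicategory.comp_whiskerRight, Category.assoc,
        η.counitCell_naturality])

/-- The naturality of `counitWhisker` in the SMC-functor. -/
def counitWhiskerNaturality {F F' : SMCFunctor B D} (θ : MonoidalTrans F F') :
    ((θ.postcompose G).postcompose J).comp (η.counitWhisker F') ≅
      (η.counitWhisker F).comp θ :=
  modIso (fun a => η.counitCell (θ.app a)) (by
    intro a b f
    change J.map (G.map (F.map f)) ◁ (η.counitCell (θ.app b)).hom ≫
        (α_ _ _ _).inv ≫ (η.counitCell (F.map f)).hom ▷ θ.app b ≫ (α_ _ _ _).hom ≫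
          η.counitApp (F.obj a) ◁ (θ.naturality f).hom ≫ (α_ _ _ _).inv =
      ((α_ _ _ _).inv ≫ ((J.mapComp (G.map (F.map f)) (G.map (θ.app b))).inv ≫
          J.map₂ ((G.mapComp (F.map f) (θ.app b)).inv ≫ G.map₂ (θ.naturality f).hom ≫
            (G.mapComp (θ.app a) (F'.map f)).hom) ≫
          (J.mapComp (G.map (θ.app a)) (G.map (F'.map f))).hom) ▷ η.counitApp (F'.obj b) ≫
        (α_ _ _ _).hom ≫ J.map (G.map (θ.app a)) ◁ (η.counitCell (F'.map f)).hom ≫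
          (α_ _ _ _).inv) ≫ (η.counitCell (θ.app a)).hom ▷ F'.map f
    -- The `2`-cell of `θ` at `f` goes from `F f ≫ θ b` to `θ a ≫ F' f`. Naturality of `η` at it,
    -- with the cells at both composites expanded, is the modification law up to compositors.
    have h := η.counitCell_naturality (θ.naturality f).hom
    rw [η.counitCell_comp, η.counitCell_comp] at h
    simp only [Bicategory.comp_whiskerRight, Category.assoc] at h
    -- The goal contains inverse compositors of `J` and of `G` at `F f ≫ θ b`, whereas `h` contains
    -- the compositors themselves. Precomposing with them brings the goal to the shape of `h`.
    rw [← cancel_mono (α_ _ _ _).hom, ← cancel_epi (α_ _ _ _).hom,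
      ← cancel_epi ((J.mapComp (G.map (F.map f)) (G.map (θ.app b))).hom ▷ η.counitApp (F'.obj b)),
      ← cancel_epi (J.map₂ (G.mapComp (F.map f) (θ.app b)).hom ▷ η.counitApp (F'.obj b))]
    simp only [Category.assoc, Iso.inv_hom_id, Category.comp_id, J.map₂_comp,
      Bicategory.comp_whiskerRight, Iso.hom_inv_id_assoc, hom_inv_whiskerRight_assoc]
    -- The compositor of `G` and its inverse stand under separate applications of `J.map₂`; they
    -- cancel only once merged into one.
    rw [← h, ← comp_whiskerRight_assoc (J.map₂ (G.mapComp (F.map f) (θ.app b)).hom),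
      ← J.map₂_comp, Iso.hom_inv_id, J.map₂_id, Bicategory.id_whiskerRight, Category.id_comp])

variable (B) in
/-- A transformation `J ∘ G ⟶ 𝟙` induces a transformation `J_* ∘ G_* ⟶ 𝟙`. -/
def postcomposeCounit :
    MonoidalTrans ((SMCFunctor.postcompose B G).comp (SMCFunctor.postcompose B J))
      (SMCFunctor.id (SMCFunctor B D)) where
  app F := η.counitWhisker F
  naturality θ := η.counitWhiskerNaturality θ
  -- Each remaining law is an equation of modifications. Its component at `a` is the same law of
  -- `η`, taken at the object `F a`, the `1`-cell `θ a` or the `2`-cell `Γ a` of `D`.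
  naturality_naturality Γ := mod_ext fun a => η.naturality_naturality (modApp Γ a)
  naturality_id F := mod_ext fun a => η.naturality_id (F.obj a)
  naturality_comp θ ι := mod_ext fun a => η.naturality_comp (θ.app a) (ι.app a)
  isMonoidal F F' := SMCFunctor.isMonoidal_mk
    (mod_ext fun a => (η.isMonoidal (F.obj a) (F'.obj a)).unit)
    (fun θ ι => mod_ext fun a => (η.isMonoidal (F.obj a) (F'.obj a)).tensor (θ.app a) (ι.app a))

end Counit

/-! ### Transformations from the identity to `J ∘ G`, and what they induce on `J_* ∘ G_*`. -/

section Unit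

variable (η : MonoidalTrans (SMCFunctor.id D) (G.comp J))

/-- The component of `η : 𝟙 ⟶ J ∘ G` at an object. -/
def unitApp (a : D) : a ⟶ J.obj (G.obj a) := η.app a

/-- The `2`-cell of `η : 𝟙 ⟶ J ∘ G` at a `1`-cell. -/
def unitCell {a b : D} (f : a ⟶ b) :
    f ≫ η.unitApp b ≅ η.unitApp a ≫ J.map (G.map f) := η.naturality f

lemma unitCell_naturality {a b : D} {f g : a ⟶ b} (φ : f ⟶ g) :
    φ ▷ η.unitApp b ≫ (η.unitCell g).hom =
      (η.unitCell f).hom ≫ η.unitApp a ◁ J.map₂ (G.map₂ φ) :=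
  η.naturality_naturality φ

/-- Now the identity functor is the source, so its constraint disappears from the right side, while
the constraint of `J ∘ G` stays after the cell. Unlike the counit laws, this one and the next
determine the cell followed by that constraint. -/
lemma unitCell_id (a : D) :
    (η.unitCell (𝟙 a)).hom ≫
        η.unitApp a ◁ (J.map₂ (G.mapId a).hom ≫ (J.mapId (G.obj a)).hom) =
      (λ_ (η.unitApp a)).hom ≫ (ρ_ (η.unitApp a)).inv := by
  refine (η.naturality_id a).trans ?_
  change 𝟙 (𝟙 a) ▷ η.unitApp a ≫ (λ_ (η.unitApp a)).hom ≫ (ρ_ (η.unitApp a)).inv = _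
  simp

lemma unitCell_comp {a b c : D} (f : a ⟶ b) (g : b ⟶ c) :
    (η.unitCell (f ≫ g)).hom ≫
        η.unitApp a ◁ (J.map₂ (G.mapComp f g).hom ≫ (J.mapComp (G.map f) (G.map g)).hom) =
      (α_ _ _ _).hom ≫ f ◁ (η.unitCell g).hom ≫
        (α_ _ _ _).inv ≫ (η.unitCell f).hom ▷ J.map (G.map g) ≫ (α_ _ _ _).hom := by
  refine (η.naturality_comp f g).trans ?_
  change 𝟙 (f ≫ g) ▷ η.unitApp c ≫ (α_ _ _ _).hom ≫ f ◁ (η.unitCell g).hom ≫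
    (α_ _ _ _).inv ≫ (η.unitCell f).hom ▷ J.map (G.map g) ≫ (α_ _ _ _).hom = _
  simp

lemma unitCell_zero (a b : D) :
    (nullR a (η.unitApp b)).hom ≫ (η.unitCell 𝟬).hom =
      (nullL (η.unitApp a) (J.obj (G.obj b))).hom ≫
        η.unitApp a ◁ ((J.mapZero _ _).hom ≫ J.map₂ (G.mapZero a b).hom) := by
  refine Eq.trans ?_ (η.naturality_zero a b)
  change _ = (nullR a (η.unitApp b)).hom ≫ 𝟙 (𝟬 : a ⟶ b) ▷ η.unitApp b ≫ (η.unitCell 𝟬).hom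
  simp

lemma unitCell_sum {a b : D} (f g : a ⟶ b) :
    (distribR f g (η.unitApp b)).hom ≫ (η.unitCell (f ⊞ g)).hom =
      ((η.unitCell f).hom ⊞ₘ (η.unitCell g).hom) ≫
        (distribL (η.unitApp a) (J.map (G.map f)) (J.map (G.map g))).hom ≫
          η.unitApp a ◁ ((J.mapSum _ _).hom ≫ J.map₂ (G.mapSum f g).hom) := by
  refine Eq.trans ?_ (η.naturality_sum f g)
  change _ = (distribR f g (η.unitApp b)).hom ≫ 𝟙 (f ⊞ g) ▷ η.unitApp b ≫
    (η.unitCell (f ⊞ g)).hom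
  simp

/-- The whiskering of `η : 𝟙 ⟶ J ∘ G` with an SMC-functor `F`. -/
def unitWhisker (F : SMCFunctor B D) : MonoidalTrans F ((F.comp G).comp J) where
  app a := η.unitApp (F.obj a)
  naturality f := η.unitCell (F.map f)
  naturality_naturality φ := η.unitCell_naturality (F.map₂ φ)
  naturality_id a := by
    change (η.unitCell (F.map (𝟙 a))).hom ≫ η.unitApp (F.obj a) ◁
        (J.map₂ (G.map₂ (F.mapId a).hom ≫ (G.mapId (F.obj a)).hom) ≫
          (J.mapId (G.obj (F.obj a))).hom) =
      (F.mapId a).hom ▷ η.unitApp (F.obj a) ≫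
        (λ_ (η.unitApp (F.obj a))).hom ≫ (ρ_ (η.unitApp (F.obj a))).inv
    -- Here the unit constraint of `F` starts on the source side; the unit law is used backwards to
    -- create a cell of `η`, across which the constraint slides.
    rw [← η.unitCell_id, reassoc_of% η.unitCell_naturality]
    simp only [J.map₂_comp, Bicategory.whiskerLeft_comp, Category.assoc]
  naturality_comp {a b c} f g := by
    change (η.unitCell (F.map (f ≫ g))).hom ≫ η.unitApp (F.obj a) ◁
        (J.map₂ (G.map₂ (F.mapComp f g).hom ≫ (G.mapComp (F.map f) (F.map g)).hom) ≫
          (J.mapComp (G.map (F.map f)) (G.map (F.map g))).hom) =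
      (F.mapComp f g).hom ▷ η.unitApp (F.obj c) ≫
        (α_ _ _ _).hom ≫ F.map f ◁ (η.unitCell (F.map g)).hom ≫
        (α_ _ _ _).inv ≫ (η.unitCell (F.map f)).hom ▷ J.map (G.map (F.map g)) ≫ (α_ _ _ _).hom
    rw [← η.unitCell_comp, reassoc_of% η.unitCell_naturality]
    simp only [J.map₂_comp, Bicategory.whiskerLeft_comp, Category.assoc]
  isMonoidal a b := SMCFunctor.isMonoidal_mk
    (by
      change ((nullR _ (η.unitApp (F.obj b))).hom ≫
          (F.mapZero a b).hom ▷ η.unitApp (F.obj b)) ≫ (η.unitCell (F.map 𝟬)).hom =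
        (nullL (η.unitApp (F.obj a)) _).hom ≫ η.unitApp (F.obj a) ◁ ((J.mapZero _ _).hom ≫
          J.map₂ ((G.mapZero _ _).hom ≫ G.map₂ (F.mapZero a b).hom))
      rw [Category.assoc, η.unitCell_naturality, reassoc_of% η.unitCell_zero]
      simp only [J.map₂_comp, Bicategory.whiskerLeft_comp, Category.assoc])
    (fun f g => by
      change ((distribR _ _ (η.unitApp (F.obj b))).hom ≫
          (F.mapSum f g).hom ▷ η.unitApp (F.obj b)) ≫ (η.unitCell (F.map (f ⊞ g))).hom =
        ((η.unitCell (F.map f)).hom ⊞ₘ (η.unitCell (F.map g)).hom) ≫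
          (distribL (η.unitApp (F.obj a)) _ _).hom ≫
            η.unitApp (F.obj a) ◁ ((J.mapSum _ _).hom ≫
              J.map₂ ((G.mapSum _ _).hom ≫ G.map₂ (F.mapSum f g).hom))
      rw [Category.assoc, η.unitCell_naturality, reassoc_of% η.unitCell_sum]
      simp only [J.map₂_comp, Bicategory.whiskerLeft_comp, Category.assoc])

/-- The naturality of `unitWhisker` in the SMC-functor. -/
def unitWhiskerNaturality {F F' : SMCFunctor B D} (θ : MonoidalTrans F F') :
    θ.comp (η.unitWhisker F') ≅
      (η.unitWhisker F).comp ((θ.postcompose G).postcompose J) :=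
  modIso (fun a => η.unitCell (θ.app a)) (by
    intro a b f
    change F.map f ◁ (η.unitCell (θ.app b)).hom ≫
        (α_ _ _ _).inv ≫ (η.unitCell (F.map f)).hom ▷ J.map (G.map (θ.app b)) ≫
          (α_ _ _ _).hom ≫ η.unitApp (F.obj a) ◁
            ((J.mapComp (G.map (F.map f)) (G.map (θ.app b))).inv ≫
              J.map₂ ((G.mapComp (F.map f) (θ.app b)).inv ≫ G.map₂ (θ.naturality f).hom ≫
                (G.mapComp (θ.app a) (F'.map f)).hom) ≫
              (J.mapComp (G.map (θ.app a)) (G.map (F'.map f))).hom) ≫ (α_ _ _ _).inv =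
      ((α_ _ _ _).inv ≫ (θ.naturality f).hom ▷ η.unitApp (F'.obj b) ≫ (α_ _ _ _).hom ≫
        θ.app a ◁ (η.unitCell (F'.map f)).hom ≫ (α_ _ _ _).inv) ≫
          (η.unitCell (θ.app a)).hom ▷ J.map (G.map (F'.map f))
    have h₁ := η.unitCell_comp (F.map f) (θ.app b)
    have h₂ := η.unitCell_comp (θ.app a) (F'.map f)
    rw [← cancel_mono (α_ _ _ _).hom, ← cancel_epi (α_ _ _ _).hom]
    simp only [Category.assoc, Iso.inv_hom_id, Category.comp_id, Iso.hom_inv_id_assoc]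
    -- Fold the right side into the cell at `θ a ≫ F' f`, move the `2`-cell of `θ` across it, and
    -- fold the left side into the cell at `F f ≫ θ b`. Only compositors of `J` and `G` against
    -- their inverses are left.
    rw [← h₂, reassoc_of% η.unitCell_naturality, ← reassoc_of% h₁]
    simp only [J.map₂_comp, Bicategory.whiskerLeft_comp, Category.assoc,
      whiskerLeft_hom_inv_assoc]
    rw [← whiskerLeft_comp_assoc _ (J.map₂ _), ← J.map₂_comp, Iso.hom_inv_id, J.map₂_id,
      Bicategory.whiskerLeft_id, Category.id_comp])

variable (B) in
/-- A transformation `𝟙 ⟶ J ∘ G` induces a transformation `𝟙 ⟶ J_* ∘ G_*`. -/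
def postcomposeUnit :
    MonoidalTrans (SMCFunctor.id (SMCFunctor B D))
      ((SMCFunctor.postcompose B G).comp (SMCFunctor.postcompose B J)) where
  app F := η.unitWhisker F
  naturality θ := η.unitWhiskerNaturality θ
  naturality_naturality Γ := mod_ext fun a => η.naturality_naturality (modApp Γ a)
  naturality_id F := mod_ext fun a => η.naturality_id (F.obj a)
  naturality_comp θ ι := mod_ext fun a => η.naturality_comp (θ.app a) (ι.app a)
  isMonoidal F F' := SMCFunctor.isMonoidal_mk
    (mod_ext fun a => (η.isMonoidal (F.obj a) (F'.obj a)).unit)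
    (fun θ ι => mod_ext fun a => (η.isMonoidal (F.obj a) (F'.obj a)).tensor (θ.app a) (ι.app a))

end Unit

/-! ### Invertible modifications between the induced transformations. -/

/-- The component at an object of an invertible modification. -/
def modIsoApp {F F' : SMCFunctor B C} {η θ : MonoidalTrans F F'} (Γ : η ≅ θ) (a : B) :
    η.app a ≅ θ.app a where
  hom := modApp Γ.hom a
  inv := modApp Γ.inv a
  hom_inv_id := congrArg (modApp · a) Γ.hom_inv_id
  inv_hom_id := congrArg (modApp · a) Γ.inv_hom_id

variable {η : MonoidalTrans (G.comp J) (SMCFunctor.id D)}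
  {θ : MonoidalTrans (SMCFunctor.id D) (G.comp J)}

variable (B) in
/-- An isomorphism `θ ≫ η ≅ 𝟙` induces an isomorphism of the induced transformations. -/
def postcomposeUnitCounit (Γ : θ.comp η ≅ MonoidalTrans.id (SMCFunctor.id D)) :
    (θ.postcomposeUnit B).comp (η.postcomposeCounit B) ≅
      MonoidalTrans.id (SMCFunctor.id (SMCFunctor B D)) :=
  modIso
    -- The modification law of `Γ` serves at two levels: at `F f` it makes each component a
    -- modification, and at `ι a` it makes these components compatible with a transformation `ι` of
    -- SMC-functors.
    (fun F => modIso (η := (θ.unitWhisker F).comp (η.counitWhisker F)) (θ := MonoidalTrans.id F)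
      (fun a => modIsoApp Γ (F.obj a))
      (fun f => Pseudofunctor.StrongTrans.Modification.naturality Γ.hom (F.map f)))
    (fun ι => mod_ext fun a =>
      Pseudofunctor.StrongTrans.Modification.naturality Γ.hom (ι.app a))

variable (B) in
/-- An isomorphism `η ≫ θ ≅ 𝟙` induces an isomorphism of the induced transformations. -/
def postcomposeCounitUnit (Γ : η.comp θ ≅ MonoidalTrans.id (G.comp J)) :
    (η.postcomposeCounit B).comp (θ.postcomposeUnit B) ≅
      MonoidalTrans.id ((SMCFunctor.postcompose B G).comp (SMCFunctor.postcompose B J)) :=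
  modIso
    (fun F => modIso (η := (η.counitWhisker F).comp (θ.unitWhisker F))
      (θ := MonoidalTrans.id ((F.comp G).comp J))
      (fun a => modIsoApp Γ (F.obj a))
      (fun f => Pseudofunctor.StrongTrans.Modification.naturality Γ.hom (F.map f)))
    (fun ι => mod_ext fun a =>
      Pseudofunctor.StrongTrans.Modification.naturality Γ.hom (ι.app a))

end
end MonoidalTrans

/-! ### The biequivalence. -/

theorem lemma7p7 {B : Type u₁} [Bicategory.{w₁, v₁} B] [SMCCategory B]
    {C : Type u₂} [Bicategory.{w₂, v₂} C] [SMCCategory C]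
    {D : Type u₃} [Bicategory.{w₃, v₃} D] [SMCCategory D]
    (J : SMCFunctor C D) (hJ : J.IsBiequivalence) :
    (SMCFunctor.postcompose B J).IsBiequivalence := by
  obtain ⟨G, ⟨e⟩, ⟨e'⟩⟩ := hJ
  exact ⟨SMCFunctor.postcompose B G,
    -- Two invertible modifications suffice: the counit is corrected to satisfy the triangle
    -- identity, so the triangle identity of `e` need not be transported.
    ⟨Bicategory.Equivalence.mkOfAdjointifyCounit
      (f := MonoidalTrans.postcomposeCounit B e.hom) (g := MonoidalTrans.postcomposeUnit B e.inv)
      (MonoidalTrans.postcomposeCounitUnit B e.unit.symm).symm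
      (MonoidalTrans.postcomposeUnitCounit B e.counit)⟩,
    -- The constructions are reused with `G` and `J`, and `C` and `D`, exchanged. Since `e'` starts
    -- at the identity, its forward direction is of unit type and its inverse of counit type.
    ⟨Bicategory.Equivalence.mkOfAdjointifyCounit
      (f := MonoidalTrans.postcomposeUnit B e'.hom) (g := MonoidalTrans.postcomposeCounit B e'.inv)
      (MonoidalTrans.postcomposeUnitCounit B e'.unit.symm).symm
      (MonoidalTrans.postcomposeCounitUnit B e'.counit)⟩⟩
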